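/- **Conventions.** A metric measure space $(X,d,m)$ is a complete separable metric space with a Borel measure $m\ge 0$ that is finite on bounded sets; it is pointed if a base point in $\operatorname{spt}(m)$ is chosen. Two pointed spaces are isomorphic if there is a measure-preserving isometric bijection between them that respects the base points. $B_r(x)$ denotes an open ball. * For $f:X\to\mathbb R$ put $\operatorname{lip}(f)(x)=\limsup_{y\to x}|f(y)-f(x)|/d(y,x)$ (and $0$ at isolated points). $H^{1,2}(X)$ is the set of $f\in L^2(m)$ for which there are boundedly supported Lipschitz functions $f_n\to f$ in $L^2(m)$ with $\sup_n\int \operatorname{lip}(f_n)^2\,dm<\infty$, with the norm $\|f\|_{H^{1,2}}^2=\int|f|^2\,dm+\inf\liminf_n\int\operatorname{lip}(f_n)^2\,dm$, the infimum being over all sequences of boundedly supported Lipschitz functions $f_n\to f$ in $L^2(m)$. The space is infinitesimally Hilbertian if the (Banach) space $H^{1,2}(X)$ is a Hilbert space, and infinitesimally non-Hilbertian otherwise. * It is $k$-Ahlfors regular ($k\ge1$) if for some $\alpha\ge1$ one has $\alpha^{-1}r^k\le m(B_r(x))\le\alpha r^k$ for all $x\in X$ and $0<r<\operatorname{diam}X$.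 * It is $m$-rectifiable if, up to an $m$-null set, it is a countable disjoint union of Borel sets $U_i$ that are biLipschitz equivalent to subsets of $\mathbb R^{n_i}$ and satisfy $m|_{U_i}\ll\mathcal H^{n_i}$. * For $p\in\operatorname{spt}(m)$, a pointed metric measure space $(Y,d_Y,m_Y,q)$ belongs to the tangent cone $\operatorname{Tan}_p(X,d,m)$ if there are radii $r_k\searrow0$ such that for every $\varepsilon\in(0,1)$ and a.e. $R>1$ there are $\bar k$ and Borel maps $\psi^k:B_{Rr_k}(p)\to Y$ $(k\ge\bar k)$ with: $\psi^k(p)=q$; $|d(x,y)-r_kd_Y(\psi^k(x),\psi^k(y))|\le\varepsilon r_k$ for all $x,y\in B_{Rr_k}(p)$; $B_{R-\varepsilon}(q)$ lies in the open $\varepsilon$-neighbourhood of $\psi^k(B_{Rr_k}(p))$; and $m(B_{r_k}(p))^{-1}\psi^k_\#(m|_{B_{Rr_k}(p)})\rightharpoonup m_Y|_{B_R(q)}$ as $k\to\infty$ against bounded continuous functions with bounded support. **Theorem.** There is a Cantor set $C\subset\mathbb R$ (non-empty, compact, perfect, totally disconnected) of positive Lebesgue measure such that $X=C\times C$, with $d(a,b)=|a_1-b_1|+|a_2-b_2|$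 and $m=\mathcal L^2|_X$, is a metric measure space that is infinitesimally Hilbertian, $m$-rectifiable and $2$-Ahlfors regular; moreover $H^{1,2}(X)=L^2(m)$ and $\|f\|_{H^{1,2}}=\|f\|_{L^2}$ for every $f$. For $m$-a.e. $x\in X$ we have $x\in\operatorname{spt}(m)$, and $\operatorname{Tan}_x(X,d,m)$ has, up to isomorphism, the unique element $\big(\mathbb R^2,\ell^1,\mathcal L^2/\mathcal L^2(B_1(0)),0\big)$, where $B_1(0)$ is the $\ell^1$ unit ball; this space is infinitesimally non-Hilbertian. In particular, there is an infinitesimally Hilbertian, $m$-rectifiable, Ahlfors regular metric measure space whose tangent cone at $m$-a.e. point contains a unique, infinitesimally non-Hilbertian element. -/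

import Mathlib

open MeasureTheory Filter Topology Set
open scoped ENNReal NNReal BoundedContinuousFunction

universe u v

namespace MMS

section Sobolev

variable {X : Type u} [MetricSpace X]

/-- The slope `lip f x = limsup_{y → x, y ≠ x} |f y - f x| / d(y, x)`, as an extended real. At an
isolated point the punctured neighbourhood filter is trivial and the value is `0`. -/
noncomputable def slope (f : X → ℝ) (x : X) : ℝ≥0∞ :=
  limsup (fun y => ENNReal.ofReal (|f y - f x| / dist y x)) (𝓝[≠] x)

/-- Lipschitz functions with bounded support. -/
def IsBddSuppLipschitz (f : X → ℝ) : Prop :=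
  (∃ K : ℝ≥0, LipschitzWith K f) ∧ Bornology.IsBounded (Function.support f)

theorem slope_zero (x : X) : slope (0 : X → ℝ) x = 0 := by
  have h : (fun y : X => ENNReal.ofReal (|(0 : X → ℝ) y - (0 : X → ℝ) x| / dist y x)) =
      fun _ => (⊥ : ℝ≥0∞) := by
    ext y
    simp
  unfold slope
  rw [h, limsup_const_bot]
  rfl

theorem slope_const_mul (c : ℝ) (f : X → ℝ) (x : X) :
    slope (fun y => c * f y) x = ENNReal.ofReal |c| * slope f x := by
  unfold slope
  rw [← ENNReal.limsup_const_mul_of_ne_top ENNReal.ofReal_ne_top]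
  congr 1
  ext y
  rw [← mul_sub, abs_mul, mul_div_assoc, ENNReal.ofReal_mul (abs_nonneg c)]

theorem slope_add_le (f g : X → ℝ) (x : X) :
    slope (fun y => f y + g y) x ≤ slope f x + slope g x := by
  refine ENNReal.le_of_forall_pos_le_add fun ε hε hfin => ?_
  have hf : slope f x ≠ ⊤ := (ENNReal.add_lt_top.1 hfin).1.ne
  have hg : slope g x ≠ ⊤ := (ENNReal.add_lt_top.1 hfin).2.ne
  have hε2 : ((ε / 2 : ℝ≥0) : ℝ≥0∞) ≠ 0 := by
    simpa using hε.ne'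
  have h1 := eventually_lt_of_limsup_lt (f := 𝓝[≠] x)
    (show slope f x < slope f x + (ε / 2 : ℝ≥0) from ENNReal.lt_add_right hf hε2)
  have h2 := eventually_lt_of_limsup_lt (f := 𝓝[≠] x)
    (show slope g x < slope g x + (ε / 2 : ℝ≥0) from ENNReal.lt_add_right hg hε2)
  refine limsup_le_of_le (by isBoundedDefault) ?_
  filter_upwards [h1, h2] with y h1 h2
  have e : (ε : ℝ≥0∞) = (ε / 2 : ℝ≥0) + (ε / 2 : ℝ≥0) := by
    rw [← ENNReal.coe_add, add_halves]
  calc ENNReal.ofReal (|f y + g y - (f x + g x)| / dist y x)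
      ≤ ENNReal.ofReal (|f y - f x| / dist y x + |g y - g x| / dist y x) := by
        apply ENNReal.ofReal_le_ofReal
        rw [← add_div]
        gcongr
        rw [add_sub_add_comm]
        exact abs_add_le _ _
    _ ≤ ENNReal.ofReal (|f y - f x| / dist y x) + ENNReal.ofReal (|g y - g x| / dist y x) :=
        ENNReal.ofReal_add_le
    _ ≤ (slope f x + (ε / 2 : ℝ≥0)) + (slope g x + (ε / 2 : ℝ≥0)) := add_le_add h1.le h2.le
    _ = slope f x + slope g x + ε := by rw [e]; ring

variable [MeasurableSpace X] [BorelSpace X]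

theorem measurable_slope {f : X → ℝ} (hf : Continuous f) : Measurable (slope f) := by
  have hrep : slope f = fun x => ⨅ n : ℕ, ⨆ y ∈ Metric.ball x (1 / ((n : ℝ) + 1)) ∩ {x}ᶜ,
      ENNReal.ofReal (|f y - f x| / dist y x) := by
    ext x
    have hb : (𝓝[≠] x).HasBasis (fun _ : ℕ => True)
        fun n => Metric.ball x (1 / ((n : ℝ) + 1)) ∩ {x}ᶜ :=
      nhdsWithin_hasBasis Metric.nhds_basis_ball_inv_nat_succ _
    unfold slope
    rw [hb.limsup_eq_iInf_iSup]
    simp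
  rw [hrep]
  refine Measurable.iInf fun n => measurable_of_Ioi fun c => ?_
  have hset : (fun x => ⨆ y ∈ Metric.ball x (1 / ((n : ℝ) + 1)) ∩ {x}ᶜ,
      ENNReal.ofReal (|f y - f x| / dist y x)) ⁻¹' Ioi c =
      ⋃ y, ((Metric.ball y (1 / ((n : ℝ) + 1)) ∩ {y}ᶜ) ∩
        (fun x => ENNReal.ofReal (|f y - f x| / dist y x)) ⁻¹' Ioi c) := by
    ext x
    simp only [mem_preimage, mem_Ioi, lt_iSup_iff, mem_iUnion, mem_inter_iff, Metric.mem_ball,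
      mem_compl_iff, mem_singleton_iff, exists_prop]
    refine exists_congr fun y => ?_
    rw [dist_comm y x, eq_comm (a := y)]
  rw [hset]
  refine (isOpen_iUnion fun y => ContinuousOn.isOpen_inter_preimage ?_
    (Metric.isOpen_ball.inter isOpen_compl_singleton) isOpen_Ioi).measurableSet
  refine ENNReal.continuous_ofReal.comp_continuousOn ?_
  refine ContinuousOn.div (by fun_prop) (by fun_prop) fun x hx => ?_
  exact dist_ne_zero.2 fun h => hx.2 h.symm

variable (m : Measure X)

/-- `∫ (lip f)² dm`. -/
noncomputable def slopeEnergy (f : X → ℝ) : ℝ≥0∞ := ∫⁻ x, slope f x ^ 2 ∂m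

/-- `w` is a sequence of boundedly supported Lipschitz functions converging to `f` in `L²(m)`. -/
def IsApproxSeq (f : Lp ℝ 2 m) (w : ℕ → X → ℝ) : Prop :=
  (∀ n, IsBddSuppLipschitz (w n)) ∧
    Tendsto (fun n => eLpNorm (fun x => w n x - f x) 2 m) atTop (𝓝 0)

theorem slopeEnergy_add_le {f g : X → ℝ} (hf : Continuous f) :
    slopeEnergy m (fun x => f x + g x) ≤ 2 * slopeEnergy m f + 2 * slopeEnergy m g := by
  have key : ∀ a b : ℝ≥0∞, (a + b) ^ 2 ≤ 2 * a ^ 2 + 2 * b ^ 2 := by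
    intro a b
    have h := ENNReal.rpow_add_le_mul_rpow_add_rpow a b (p := 2) (by norm_num)
    have h2 : (2 : ℝ≥0∞) ^ ((2 : ℝ) - 1) = 2 := by norm_num
    rw [h2, mul_add] at h
    simpa using h
  unfold slopeEnergy
  have hm : Measurable fun x => 2 * slope f x ^ 2 :=
    ((measurable_slope hf).pow_const 2).const_mul 2
  calc ∫⁻ x, slope (fun y => f y + g y) x ^ 2 ∂m
      ≤ ∫⁻ x, (2 * slope f x ^ 2 + 2 * slope g x ^ 2) ∂m := by
        refine lintegral_mono fun x => ?_
        refine le_trans ?_ (key _ _)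
        gcongr
        exact slope_add_le f g x
    _ = _ := by
        rw [lintegral_add_left hm, lintegral_const_mul' _ _ (by simp),
          lintegral_const_mul' _ _ (by simp)]

/-- The Sobolev space `H^{1,2}(X)`: those `f ∈ L²(m)` admitting boundedly supported Lipschitz
functions `w n → f` in `L²(m)` with `sup_n ∫ (lip (w n))² dm < ∞`. -/
noncomputable def sobolevSpace : Submodule ℝ (Lp ℝ 2 m) where
  carrier := {f | ∃ w : ℕ → X → ℝ, IsApproxSeq m f w ∧ ⨆ n, slopeEnergy m (w n) < ⊤}
  zero_mem' := by
    refine ⟨fun _ => 0, ⟨fun _ => ⟨⟨0, LipschitzWith.const 0⟩, by simp⟩, ?_⟩, ?_⟩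
    · have : ∀ n : ℕ, eLpNorm (fun x => (0 : X → ℝ) x - (0 : Lp ℝ 2 m) x) 2 m = 0 := by
        intro n
        rw [eLpNorm_congr_ae (g := 0), eLpNorm_zero]
        filter_upwards [Lp.coeFn_zero ℝ 2 m] with x hx
        rw [hx]
        simp
      exact (tendsto_congr this).2 tendsto_const_nhds
    · simp [slopeEnergy, slope_zero]
  add_mem' := by
    rintro f g ⟨w, ⟨hw, hwf⟩, hwE⟩ ⟨z, ⟨hz, hzg⟩, hzE⟩
    have hcont : ∀ n, Continuous (w n) := fun n => (hw n).1.choose_spec.continuous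
    have hcont' : ∀ n, Continuous (z n) := fun n => (hz n).1.choose_spec.continuous
    refine ⟨fun n x => w n x + z n x, ⟨fun n => ⟨?_, ?_⟩, ?_⟩, ?_⟩
    · obtain ⟨K, hK⟩ := (hw n).1
      obtain ⟨L, hL⟩ := (hz n).1
      exact ⟨K + L, hK.add hL⟩
    · exact ((hw n).2.union (hz n).2).subset (Function.support_add _ _)
    · refine tendsto_of_tendsto_of_tendsto_of_le_of_le tendsto_const_nhds
        (by simpa using hwf.add hzg) (fun _ => zero_le) fun n => ?_
      refine le_trans (le_of_eq ?_) (eLpNorm_add_le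
        ((hcont n).measurable.aestronglyMeasurable.sub (Lp.aestronglyMeasurable f))
        ((hcont' n).measurable.aestronglyMeasurable.sub (Lp.aestronglyMeasurable g))
        (by norm_num))
      refine eLpNorm_congr_ae ?_
      filter_upwards [Lp.coeFn_add f g] with x hx
      simp only [hx, Pi.add_apply]
      ring
    · refine lt_of_le_of_lt (iSup_le fun n => (slopeEnergy_add_le m (hcont n)).trans
        (add_le_add (mul_le_mul_right (le_iSup (fun n => slopeEnergy m (w n)) n) 2)
          (mul_le_mul_right (le_iSup (fun n => slopeEnergy m (z n)) n) 2))) ?_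
      exact ENNReal.add_lt_top.2
        ⟨ENNReal.mul_lt_top (by simp) hwE, ENNReal.mul_lt_top (by simp) hzE⟩
  smul_mem' := by
    rintro c f ⟨w, ⟨hw, hwf⟩, hwE⟩
    have hE : ∀ n, slopeEnergy m (fun x => c * w n x) =
        ENNReal.ofReal |c| ^ 2 * slopeEnergy m (w n) := by
      intro n
      unfold slopeEnergy
      rw [← lintegral_const_mul' _ _ (by finiteness)]
      refine lintegral_congr fun x => ?_
      rw [slope_const_mul, mul_pow]
    refine ⟨fun n x => c * w n x, ⟨fun n => ⟨?_, ?_⟩, ?_⟩, ?_⟩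
    · obtain ⟨K, hK⟩ := (hw n).1
      exact ⟨‖c‖₊ * K, (lipschitzWith_smul c).comp hK⟩
    · exact (hw n).2.subset fun x hx => right_ne_zero_of_mul hx
    · have h : ∀ n, eLpNorm (fun x => c * w n x - (c • f : Lp ℝ 2 m) x) 2 m =
          ‖c‖ₑ * eLpNorm (fun x => w n x - f x) 2 m := by
        intro n
        rw [← eLpNorm_const_smul]
        refine eLpNorm_congr_ae ?_
        filter_upwards [Lp.coeFn_smul c f] with x hx
        simp [hx, mul_sub]
      refine (tendsto_congr h).2 ?_
      simpa using ENNReal.Tendsto.const_mul hwf (Or.inr (by simp))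
    · simp_rw [hE, ← ENNReal.mul_iSup]
      exact ENNReal.mul_lt_top (by finiteness) hwE

/-- `inf liminf_n ∫ (lip (w n))² dm` over all sequences of boundedly supported Lipschitz functions
`w n` converging to `f` in `L²(m)`. -/
noncomputable def relaxedEnergy (f : Lp ℝ 2 m) : ℝ≥0∞ :=
  ⨅ (w : ℕ → X → ℝ) (_ : IsApproxSeq m f w), liminf (fun n => slopeEnergy m (w n)) atTop

/-- The Sobolev norm; the relaxed energy is finite on the Sobolev space. -/
noncomputable def sobolevNorm (f : sobolevSpace m) : ℝ :=
  √(‖(f : Lp ℝ 2 m)‖ ^ 2 + (relaxedEnergy m (f : Lp ℝ 2 m)).toReal)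

/-- The Sobolev space, which is always complete, is a Hilbert space: its norm is induced by an
inner product. -/
def IsInfinitesimallyHilbertian : Prop :=
  ∃ c : InnerProductSpace.Core ℝ (sobolevSpace m),
    ∀ f : sobolevSpace m, c.inner f f = sobolevNorm m f ^ 2

end Sobolev

section Spaces

variable {X : Type u} [MetricSpace X] [MeasurableSpace X] [BorelSpace X] (m : Measure X)

/-- `(X, d, m)` is a metric measure space: `(X, d)` is complete and separable and the Borel
measure `m` is finite on bounded sets. -/
structure IsMetricMeasureSpace : Prop where
  complete : CompleteSpace X
  separable : TopologicalSpace.SeparableSpace X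
  boundedlyFinite : ∀ s : Set X, Bornology.IsBounded s → m s < ⊤

/-- `k`-Ahlfors regularity, `k ≥ 1`: `α⁻¹ rᵏ ≤ m (B_r(x)) ≤ α rᵏ` for all `x` and all
`0 < r < diam X` (the diameter may be infinite). -/
def IsAhlforsRegular (k : ℝ) : Prop :=
  1 ≤ k ∧ ∃ α : ℝ, 1 ≤ α ∧ ∀ (x : X) (r : ℝ), 0 < r →
    ENNReal.ofReal r < Metric.ediam (univ : Set X) →
      ENNReal.ofReal (α⁻¹ * r ^ k) ≤ m (Metric.ball x r) ∧
        m (Metric.ball x r) ≤ ENNReal.ofReal (α * r ^ k)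

/-- `(U, φ)` is an `n`-chart: `U` is Borel, `m|_U ≪ ℋⁿ` and `φ : U → ℝⁿ` (Euclidean norm) is
biLipschitz onto its image. The values of `φ` off `U` are irrelevant. -/
structure IsChart (n : ℕ) (U : Set X) (φ : X → EuclideanSpace ℝ (Fin n)) : Prop where
  measurableSet : MeasurableSet U
  absolutelyContinuous : m.restrict U ≪ Measure.hausdorffMeasure (n : ℝ)
  biLipschitz : ∃ L : ℝ, 0 < L ∧ ∀ x ∈ U, ∀ y ∈ U,
    L⁻¹ * dist x y ≤ dist (φ x) (φ y) ∧ dist (φ x) (φ y) ≤ L * dist x y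

/-- `m`-rectifiability: there are countably many charts, of possibly different dimensions, whose
domains form a Borel partition of `X` up to `m`-null sets. -/
def IsRectifiable : Prop :=
  ∃ (n : ℕ → ℕ) (U : ℕ → Set X) (φ : ∀ i, X → EuclideanSpace ℝ (Fin (n i))),
    (∀ i, IsChart m (n i) (U i) (φ i)) ∧ Pairwise (fun i j => Disjoint (U i) (U j)) ∧
      m (⋃ i, U i)ᶜ = 0

end Spaces

/-- Pointed metric measure spaces: metric measure spaces with a base point in the support. -/
structure PointedMMSpace : Type (u + 1) where
  carrier : Type u
  [metricSpace : MetricSpace carrier]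
  [measurableSpace : MeasurableSpace carrier]
  [borelSpace : BorelSpace carrier]
  measure : Measure carrier
  isMetricMeasureSpace : IsMetricMeasureSpace measure
  point : carrier
  point_mem_support : point ∈ measure.support

attribute [instance] PointedMMSpace.metricSpace PointedMMSpace.measurableSpace
  PointedMMSpace.borelSpace

/-- Isomorphism: a measure preserving isometric bijection that respects the base points. -/
def PointedMMSpace.IsIsomorphic (Y : PointedMMSpace.{u}) (Z : PointedMMSpace.{v}) : Prop :=
  ∃ e : Y.carrier ≃ᵢ Z.carrier, e Y.point = Z.point ∧ Y.measure.map e = Z.measure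

section Tangent

variable {X : Type u} [MetricSpace X] [MeasurableSpace X] [BorelSpace X]

/-- The rescalings `(X, d / r k, m / m (B_{r k}(p)), p)` converge to `Y` in the pointed measured
Gromov-Hausdorff sense. The maps `ψ k` only matter on `B_{R r k}(p)`; a Borel map on that ball is
the restriction of a Borel map on `X`. -/
def RescalingsConverge (m : Measure X) (p : X) (r : ℕ → ℝ) (Y : PointedMMSpace.{v}) : Prop :=
  ∀ ε : ℝ, 0 < ε → ε < 1 → ∀ᵐ R ∂((volume : Measure ℝ).restrict (Ioi 1)),
    ∃ (k₀ : ℕ) (ψ : ℕ → X → Y.carrier),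
      (∀ k, k₀ ≤ k → Measurable (ψ k) ∧ ψ k p = Y.point ∧
        (∀ x ∈ Metric.ball p (R * r k), ∀ y ∈ Metric.ball p (R * r k),
          |dist x y - r k * dist (ψ k x) (ψ k y)| ≤ ε * r k) ∧
        Metric.ball Y.point (R - ε) ⊆ Metric.thickening ε (ψ k '' Metric.ball p (R * r k))) ∧
      ∀ f : Y.carrier →ᵇ ℝ, Bornology.IsBounded (Function.support f) →
        Tendsto (fun k => ∫ y, f y ∂((m (Metric.ball p (r k)))⁻¹ •
            (m.restrict (Metric.ball p (R * r k))).map (ψ k))) atTop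
          (𝓝 (∫ y in Metric.ball Y.point R, f y ∂Y.measure))

/-- The tangent cone `Tan_p(X, d, m)`, for `p` in the support of `m`. -/
def tangentCone (m : Measure X) (p : X) : Set PointedMMSpace.{v} :=
  {Y | p ∈ m.support ∧ ∃ r : ℕ → ℝ, (∀ k, 0 < r k) ∧ Antitone r ∧ Tendsto r atTop (𝓝 0) ∧
    RescalingsConverge m p r Y}

end Tangent

section Example

/-- Cantor sets in the line: non-empty, compact, perfect, totally disconnected. -/
structure IsCantorSet (C : Set ℝ) : Prop where
  nonempty : C.Nonempty
  isCompact : IsCompact C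
  perfect : Perfect C
  totallyDisconnected : IsTotallyDisconnected C

/-- The plane with the distance `|a₁ - b₁| + |a₂ - b₂|`. -/
abbrev L1Plane : Type := WithLp 1 (ℝ × ℝ)

/-- Lebesgue measure on the plane. -/
noncomputable def lebesgue : Measure L1Plane :=
  (volume : Measure (ℝ × ℝ)).map (WithLp.toLp 1)

theorem lebesgue_apply (s : Set L1Plane) :
    lebesgue s = (volume : Measure (ℝ × ℝ)) (WithLp.toLp 1 ⁻¹' s) :=
  (MeasurableEquiv.toLp 1 (ℝ × ℝ)).map_apply s

theorem lebesgue_lt_top {s : Set L1Plane} (hs : Bornology.IsBounded s) : lebesgue s < ⊤ := by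
  rw [lebesgue_apply]
  refine Bornology.IsBounded.measure_lt_top ?_
  obtain ⟨R, hR⟩ := hs.subset_closedBall 0
  refine Metric.isBounded_closedBall (x := (0 : ℝ × ℝ)) (r := R) |>.subset fun p hp => ?_
  have h := hR hp
  rw [Metric.mem_closedBall, WithLp.prod_dist_eq_of_L1] at h
  rw [Metric.mem_closedBall, Prod.dist_eq]
  have h1 : (0 : ℝ) ≤ dist p.1 0 := dist_nonneg
  have h2 : (0 : ℝ) ≤ dist p.2 0 := dist_nonneg
  simp at h
  simp at h1 h2
  refine max_le ?_ ?_ <;> simp <;> linarith [abs_nonneg p.1, abs_nonneg p.2]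

theorem lebesgue_pos {s : Set L1Plane} (hs : IsOpen s) (hne : s.Nonempty) : 0 < lebesgue s := by
  rw [lebesgue_apply]
  refine (hs.preimage (WithLp.prod_continuous_toLp 1 ℝ ℝ)).measure_pos _ ?_
  obtain ⟨p, hp⟩ := hne
  exact ⟨WithLp.ofLp p, hp⟩

/-- Lebesgue measure normalised by the measure of the open unit ball of the `ℓ¹` distance. -/
noncomputable def normalisedLebesgue : Measure L1Plane :=
  (lebesgue (Metric.ball 0 1))⁻¹ • lebesgue

/-- The pointed metric measure space `(ℝ², ℓ¹, normalised Lebesgue measure, 0)`. -/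
noncomputable def pointedL1Plane : PointedMMSpace.{0} where
  carrier := L1Plane
  measure := normalisedLebesgue
  isMetricMeasureSpace :=
    { complete := inferInstance
      separable := inferInstance
      boundedlyFinite := fun s hs => by
        rw [normalisedLebesgue, Measure.smul_apply, smul_eq_mul]
        exact ENNReal.mul_lt_top (ENNReal.inv_lt_top.2
          (lebesgue_pos Metric.isOpen_ball ⟨0, by simp⟩)) (lebesgue_lt_top hs) }
  point := 0
  point_mem_support := by
    rw [Measure.mem_support_iff_forall]
    intro U hU
    obtain ⟨V, hVU, hV, h0⟩ := mem_nhds_iff.1 hU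
    refine lt_of_lt_of_le ?_ (measure_mono hVU)
    rw [normalisedLebesgue, Measure.smul_apply, smul_eq_mul]
    exact ENNReal.mul_pos (ENNReal.inv_ne_zero.2 (lebesgue_lt_top Metric.isBounded_ball).ne)
      (lebesgue_pos hV ⟨0, h0⟩).ne'

/-- The square `C × C` with the distance inherited from `L1Plane`. -/
abbrev Square (C : Set ℝ) : Type := {p : L1Plane // p.fst ∈ C ∧ p.snd ∈ C}

/-- Lebesgue measure restricted to `C × C`, as a measure on `C × C`. -/
noncomputable def squareMeasure (C : Set ℝ) : Measure (Square C) :=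
  lebesgue.comap Subtype.val

end Example

end MMS

-- Energy is decided by the topology of `X` at small scales, the tangent by its measure, and a fat
-- Cantor set makes the two disagree. Since `C × C` is compact and totally disconnected, every `L²`
-- function is a limit of locally constant functions (`exists_isLocallyConstant_approx`). These are
-- Lipschitz with zero slope, so the relaxed energy vanishes and the Sobolev norm is the `L²` norm,
-- which is Hilbertian. Since `C × C` has positive measure, almost every point is a Lebesgue density
-- point, where blow-ups fill the plane and see only the ambient `ℓ¹` norm.
--
-- The Cantor set is a sum of a binary and a base `4` expansion with the same digits `0`, `1`. The
-- base `4` part opens gaps. Forgetting it is a 1-Lipschitz map onto `[0, 1]`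
-- (`abs_ofDigits_sub_le`); applied to cylinders, this bounds the measure of balls below at every
-- point and scale, which gives Ahlfors regularity.
--
-- At a density point the maps `x ↦ r⁻¹ (x - p)` are exact dilations with increasingly dense image,
-- and the rescaled measures converge (`rescalingsConverge_pointedL1Plane`). For uniqueness, an
-- arbitrary tangent `Y` along the same scales is compared with this model: an ultralimit of the
-- correspondences is an isometry from the plane onto `Y`
-- (`exists_isometryEquiv_of_isAlmostIsometric`), and testing on compactly supported functions shows
-- that it carries one limit measure to the other (`integral_eq_of_isAlmostIsometric`).
--
-- The slope for the `ℓ¹` distance is dual, of `ℓ^∞` type: if `u` depends on the first coordinate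
-- and `v` on the second, then `u ± v` has slope `max(|u'|, |v'|)`. For sawtooth functions `u`, `v`
-- of slope `1`, all of `u`, `v`, `u + v`, `u - v` have about the same energy, so the parallelogram
-- law fails by a factor of about two. The relaxed energies of `u` and `v` are bounded below by
-- difference quotients, which survive `L²` limits (`lintegral_enorm_sub_sq_le_relaxedEnergy`).

universe w

namespace MMS

/-! ### Lebesgue measure on the `ℓ¹` plane -/

section Plane

/-- The identity from the plane with the product structure to the plane with the `ℓ¹` norm. -/
noncomputable def toL1Plane : (ℝ × ℝ) ≃L[ℝ] L1Plane :=
  (WithLp.prodContinuousLinearEquiv 1 ℝ ℝ ℝ).symm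

/-- A linear isomorphism carries Haar measure to Haar measure. This supplies the scaling of `ℓ¹`
balls and translation invariance. -/
instance : lebesgue.IsAddHaarMeasure := by
  have h : lebesgue = (volume : Measure (ℝ × ℝ)).map toL1Plane := rfl
  rw [h]
  exact toL1Plane.isAddHaarMeasure_map volume

theorem L1Plane.dist_def (a b : L1Plane) : dist a b = |a.fst - b.fst| + |a.snd - b.snd| := by
  rw [WithLp.prod_dist_eq_of_L1, Real.dist_eq, Real.dist_eq]

theorem L1Plane.norm_def (a : L1Plane) : ‖a‖ = |a.fst| + |a.snd| := by
  rw [WithLp.prod_norm_eq_of_L1, Real.norm_eq_abs, Real.norm_eq_abs]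

theorem lebesgue_prod (A B : Set ℝ) :
    lebesgue {p | p.fst ∈ A ∧ p.snd ∈ B} = volume A * volume B := by
  rw [lebesgue_apply, ← Measure.prod_prod, ← Measure.volume_eq_prod]
  rfl

theorem lebesgue_ball (x : L1Plane) {r : ℝ} (hr : 0 ≤ r) :
    lebesgue (Metric.ball x r) = ENNReal.ofReal (r ^ 2) * lebesgue (Metric.ball 0 1) := by
  have h : Module.finrank ℝ L1Plane = 2 := by
    rw [← toL1Plane.toLinearEquiv.finrank_eq]; simp
  rw [Measure.addHaar_ball _ _ hr, h]

theorem lebesgue_closedBall (x : L1Plane) {r : ℝ} (hr : 0 ≤ r) :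
    lebesgue (Metric.closedBall x r) = ENNReal.ofReal (r ^ 2) * lebesgue (Metric.ball 0 1) := by
  rw [Measure.addHaar_closedBall_eq_addHaar_ball, lebesgue_ball x hr]

theorem lebesgue_unitBall_pos : 0 < lebesgue (Metric.ball 0 1) :=
  lebesgue_pos Metric.isOpen_ball ⟨0, by simp⟩

theorem lebesgue_unitBall_ne_top : lebesgue (Metric.ball 0 1) ≠ ⊤ :=
  (lebesgue_lt_top Metric.isBounded_ball).ne

end Plane

/-! ### A fat Cantor set with uniform lower volume bounds -/

section Cantor

/-- The base `4` expansion with the digits `0`, `1` prescribed by `e`. -/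
noncomputable def quaternarySum (e : ℕ → Fin 2) : ℝ :=
  Real.ofDigits fun i => Fin.castLE (show 2 ≤ 4 by norm_num) (e i)

/-- The points of the fat Cantor set. -/
noncomputable def fatPoint (e : ℕ → Fin 2) : ℝ := Real.ofDigits e + quaternarySum e

/-- A Cantor set of positive measure. -/
def fatCantor : Set ℝ := range fatPoint

/-- The bound comes from comparing with half the binary expansion term by term. The optimal constant
is `1/3`, but any bound below `1` opens gaps. -/
theorem quaternarySum_le (e : ℕ → Fin 2) : quaternarySum e ≤ 1 / 2 := by
  have h : quaternarySum e ≤ 1 / 2 * Real.ofDigits e := by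
    unfold quaternarySum Real.ofDigits
    rw [← Summable.tsum_mul_left _ Real.summable_ofDigitsTerm]
    refine Summable.tsum_mono Real.summable_ofDigitsTerm
      (Real.summable_ofDigitsTerm.mul_left _) fun i => ?_
    simp only [Real.ofDigitsTerm, Fin.val_castLE]
    have h4 : (2 : ℝ) * 2 ^ (i + 1) ≤ 4 ^ (i + 1) := by
      have : (4 : ℝ) = 2 * 2 := by norm_num
      rw [this, mul_pow]
      gcongr
      exact le_self_pow₀ (by norm_num) (by simp)
    have h5 : ((4 : ℝ) ^ (i + 1))⁻¹ ≤ 1 / 2 * ((2 : ℝ) ^ (i + 1))⁻¹ := by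
      rw [one_div, ← mul_inv]
      gcongr
    calc ((e i : ℕ) : ℝ) * (((4 : ℕ) : ℝ) ^ (i + 1))⁻¹
        ≤ ((e i : ℕ) : ℝ) * (1 / 2 * ((2 : ℝ) ^ (i + 1))⁻¹) := by
          gcongr; exact_mod_cast h5
      _ = _ := by push_cast; ring
  have := Real.ofDigits_le_one e
  linarith

theorem quaternarySum_nonneg (e : ℕ → Fin 2) : 0 ≤ quaternarySum e := Real.ofDigits_nonneg _

/-- At the first differing digit, the later binary digits can at most compensate the difference, as
in dyadic ties, while the later base `4` digits compensate at most half of it. Hence weak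
monotonicity for one sum and strict for the other. -/
theorem ofDigits_le_and_quaternarySum_lt {e e' : ℕ → Fin 2} {n : ℕ} (h : ∀ i < n, e i = e' i)
    (hn : e n = 0) (hn' : e' n = 1) :
    Real.ofDigits e ≤ Real.ofDigits e' ∧ quaternarySum e < quaternarySum e' := by
  constructor
  · rw [Real.ofDigits_eq_sum_add_ofDigits e (n + 1), Real.ofDigits_eq_sum_add_ofDigits e' (n + 1),
      Finset.sum_range_succ, Finset.sum_range_succ]
    have hs : ∑ i ∈ Finset.range n, Real.ofDigitsTerm e i =
        ∑ i ∈ Finset.range n, Real.ofDigitsTerm e' i :=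
      Finset.sum_congr rfl fun i hi => by simp [Real.ofDigitsTerm, h i (Finset.mem_range.mp hi)]
    rw [hs]
    have h1 := Real.ofDigits_le_one fun i => e (i + (n + 1))
    have h2 := Real.ofDigits_nonneg fun i => e' (i + (n + 1))
    have h3 : (0 : ℝ) < (((2 : ℕ) : ℝ) ^ (n + 1))⁻¹ := by positivity
    simp only [Real.ofDigitsTerm, hn, hn', Fin.val_zero, Fin.val_one, Nat.cast_zero,
      Nat.cast_one, zero_mul, one_mul]
    generalize (((2 : ℕ) : ℝ) ^ (n + 1))⁻¹ = q at *
    have h4 := mul_le_mul_of_nonneg_left h1 h3.le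
    have h5 := mul_nonneg h3.le h2
    linarith
  · unfold quaternarySum
    rw [Real.ofDigits_eq_sum_add_ofDigits (fun i => Fin.castLE (show 2 ≤ 4 by norm_num) (e i))
        (n + 1), Real.ofDigits_eq_sum_add_ofDigits
        (fun i => Fin.castLE (show 2 ≤ 4 by norm_num) (e' i)) (n + 1),
      Finset.sum_range_succ, Finset.sum_range_succ]
    have hs : ∑ i ∈ Finset.range n,
          Real.ofDigitsTerm (fun i => Fin.castLE (show 2 ≤ 4 by norm_num) (e i)) i =
        ∑ i ∈ Finset.range n,
          Real.ofDigitsTerm (fun i => Fin.castLE (show 2 ≤ 4 by norm_num) (e' i)) i :=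
      Finset.sum_congr rfl fun i hi => by simp [Real.ofDigitsTerm, h i (Finset.mem_range.mp hi)]
    rw [hs]
    have h1 := quaternarySum_le fun i => e (i + (n + 1))
    have h2 := quaternarySum_nonneg fun i => e' (i + (n + 1))
    unfold quaternarySum at h1 h2
    have h3 : (0 : ℝ) < (((4 : ℕ) : ℝ) ^ (n + 1))⁻¹ := by positivity
    simp only [Real.ofDigitsTerm, hn, hn', Fin.val_zero, Fin.val_one, Fin.val_castLE,
      Nat.cast_zero, Nat.cast_one, zero_mul, one_mul]
    generalize (((4 : ℕ) : ℝ) ^ (n + 1))⁻¹ = q at *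
    have h4 := mul_le_mul_of_nonneg_left h1 h3.le
    have h5 := mul_nonneg h3.le h2
    linarith

theorem ofDigits_quaternarySum_trichotomy {e e' : ℕ → Fin 2} (h : e ≠ e') :
    (Real.ofDigits e ≤ Real.ofDigits e' ∧ quaternarySum e < quaternarySum e') ∨
      (Real.ofDigits e' ≤ Real.ofDigits e ∧ quaternarySum e' < quaternarySum e) := by
  classical
  have hex : ∃ n, e n ≠ e' n := Function.ne_iff.1 h
  have hlt : ∀ i < Nat.find hex, e i = e' i := fun i hi => by
    simpa using Nat.find_min hex hi
  have hne := Nat.find_spec hex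
  have : (e (Nat.find hex) = 0 ∧ e' (Nat.find hex) = 1) ∨
      (e' (Nat.find hex) = 0 ∧ e (Nat.find hex) = 1) := by
    generalize e (Nat.find hex) = a at *
    generalize e' (Nat.find hex) = b at *
    omega
  rcases this with h1 | h1
  · exact Or.inl (ofDigits_le_and_quaternarySum_lt hlt h1.1 h1.2)
  · exact Or.inr (ofDigits_le_and_quaternarySum_lt (fun i hi => (hlt i hi).symm) h1.1 h1.2)

theorem fatPoint_injective : Function.Injective fatPoint := by
  intro e e' h
  by_contra hne
  unfold fatPoint at h
  rcases ofDigits_quaternarySum_trichotomy hne with h1 | h1 <;> linarith [h1.1, h1.2]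

/-- Both expansions move in the same direction, so dropping the base `4` part cannot increase a
distance. All lower volume bounds rest on this contraction. -/
theorem abs_ofDigits_sub_le (e e' : ℕ → Fin 2) :
    |Real.ofDigits e - Real.ofDigits e'| ≤ |fatPoint e - fatPoint e'| := by
  by_cases hne : e = e'
  · simp [hne]
  unfold fatPoint
  rcases ofDigits_quaternarySum_trichotomy hne with h1 | h1
  · rw [abs_of_nonpos (by linarith), abs_of_nonpos (by linarith)]
    linarith
  · rw [abs_of_nonneg (by linarith), abs_of_nonneg (by linarith)]
    linarith

theorem continuous_fatPoint : Continuous fatPoint := by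
  refine Real.continuous_ofDigits.add (Real.continuous_ofDigits.comp ?_)
  refine continuous_pi fun i => ?_
  exact (continuous_of_discreteTopology (f := Fin.castLE (show 2 ≤ 4 by norm_num))).comp
    (continuous_apply i)

theorem abs_fatPoint_sub_le {e e' : ℕ → Fin 2} {n : ℕ} (h : ∀ i < n, e i = e' i) :
    |fatPoint e - fatPoint e'| ≤ 2 * (1 / 2) ^ n := by
  have h1 := Real.abs_ofDigits_sub_ofDigits_le h
  have h2 : |quaternarySum e - quaternarySum e'| ≤ (((4 : ℕ) : ℝ) ^ n)⁻¹ :=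
    Real.abs_ofDigits_sub_ofDigits_le fun i hi => by simp [h i hi]
  have h3 : (((4 : ℕ) : ℝ) ^ n)⁻¹ ≤ (((2 : ℕ) : ℝ) ^ n)⁻¹ := by
    gcongr; norm_num
  have h4 : (((2 : ℕ) : ℝ) ^ n)⁻¹ = (1 / 2) ^ n := by simp
  have : fatPoint e - fatPoint e' =
      (Real.ofDigits e - Real.ofDigits e') + (quaternarySum e - quaternarySum e') := by
    unfold fatPoint; ring
  rw [this]
  refine (abs_add_le _ _).trans ?_
  linarith

theorem fatCantor_subset_Icc : fatCantor ⊆ Icc 0 2 := by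
  rintro _ ⟨e, rfl⟩
  have h1 := Real.ofDigits_le_one e
  have h2 := Real.ofDigits_nonneg e
  have h3 := quaternarySum_le e
  have h4 := quaternarySum_nonneg e
  constructor <;> unfold fatPoint <;> linarith

theorem isCompact_fatCantor : IsCompact fatCantor := isCompact_range continuous_fatPoint

theorem isCantorSet_fatCantor : IsCantorSet fatCantor where
  nonempty := range_nonempty _
  isCompact := isCompact_fatCantor
  perfect := by
    refine ⟨isCompact_fatCantor.isClosed, ?_⟩
    rintro _ ⟨e, rfl⟩
    rw [accPt_iff_nhds]
    intro U hU
    obtain ⟨δ, hδ, hU⟩ := Metric.mem_nhds_iff.1 hU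
    obtain ⟨n, hn⟩ := exists_pow_lt_of_lt_one (half_pos hδ) (show (1 / 2 : ℝ) < 1 by norm_num)
    -- Addition in `Fin 2` is modulo `2`, so adding `1` flips the digit.
    have hne : Function.update e n (e n + 1) ≠ e := by
      intro h
      have := congrFun h n
      rw [Function.update_self] at this
      generalize e n = a at this
      omega
    refine ⟨fatPoint (Function.update e n (e n + 1)), ⟨hU ?_, mem_range_self _⟩,
      fun h => hne (fatPoint_injective h)⟩
    rw [Metric.mem_ball, Real.dist_eq]
    refine (abs_fatPoint_sub_le (n := n) fun i hi => ?_).trans_lt (by linarith)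
    rw [Function.update_of_ne hi.ne]
  totallyDisconnected := by
    have := (continuous_fatPoint.isClosedEmbedding fatPoint_injective).isEmbedding
    exact this.isTotallyDisconnected_range.2 inferInstance

/-- The cylinder of sequences agreeing with `e` before `n` lies in the ball, and forgetting the base
`4` part maps it by a contraction onto an interval of length `2⁻ⁿ`. -/
theorem le_volume_fatCantor_inter_closedBall (e : ℕ → Fin 2) (n : ℕ) :
    ENNReal.ofReal ((1 / 2) ^ n) ≤
      volume (fatCantor ∩ Metric.closedBall (fatPoint e) (2 * (1 / 2) ^ n)) := by
  set S : Set (ℕ → Fin 2) := {e' | ∀ i < n, e' i = e i}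
  set h : ℝ → ℝ := Real.ofDigits ∘ Function.invFun fatPoint
  have hh : ∀ e', h (fatPoint e') = Real.ofDigits e' := fun e' => by
    simp [h, Function.leftInverse_invFun fatPoint_injective e']
  have hLip : LipschitzOnWith 1 h fatCantor := by
    refine LipschitzOnWith.of_dist_le_mul ?_
    rintro _ ⟨e1, rfl⟩ _ ⟨e2, rfl⟩
    rw [hh, hh, Real.dist_eq, Real.dist_eq, NNReal.coe_one, one_mul]
    exact abs_ofDigits_sub_le e1 e2
  set a : ℝ := ∑ i ∈ Finset.range n, Real.ofDigitsTerm e i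
  have hsub : Icc a (a + (1 / 2) ^ n) ⊆ h '' (fatPoint '' S) := by
    intro t ht
    have ht' : (t - a) * 2 ^ n ∈ Icc (0 : ℝ) 1 := by
      constructor
      · exact mul_nonneg (by linarith [ht.1]) (by positivity)
      · have : (t - a) ≤ (1 / 2) ^ n := by linarith [ht.2]
        calc (t - a) * 2 ^ n ≤ (1 / 2) ^ n * 2 ^ n := by gcongr
          _ = 1 := by rw [← mul_pow]; norm_num
    -- The digits of the rescaled remainder of `t` are appended to the first `n` digits of `e`.
    obtain ⟨d, -, hd⟩ := Real.ofDigits_SurjOn (b := 2) (by norm_num) ht'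
    set e' : ℕ → Fin 2 := fun i => if i < n then e i else d (i - n)
    have he' : e' ∈ S := fun i hi => by simp [e', hi]
    refine ⟨_, ⟨e', he', rfl⟩, ?_⟩
    rw [hh, Real.ofDigits_eq_sum_add_ofDigits e' n]
    have h1 : ∑ i ∈ Finset.range n, Real.ofDigitsTerm e' i = a :=
      Finset.sum_congr rfl fun i hi => by
        simp [Real.ofDigitsTerm, he' i (Finset.mem_range.mp hi)]
    have h2 : (fun i => e' (i + n)) = d := by
      ext i
      simp [e']
    rw [h1, h2, hd]
    field_simp
    push_cast
    ring
  have hS : fatPoint '' S ⊆ fatCantor := image_subset_range _ _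
  have hvol := hLip.mono hS |>.hausdorffMeasure_image_le (d := 1) (by norm_num)
  rw [hausdorffMeasure_real] at hvol
  calc ENNReal.ofReal ((1 / 2) ^ n) = volume (Icc a (a + (1 / 2) ^ n)) := by simp
    _ ≤ volume (h '' (fatPoint '' S)) := measure_mono hsub
    _ ≤ volume (fatPoint '' S) := by simpa using hvol
    _ ≤ _ := by
      refine measure_mono (subset_inter hS ?_)
      rintro _ ⟨e', he', rfl⟩
      rw [Metric.mem_closedBall, Real.dist_eq]
      exact abs_fatPoint_sub_le he'

/-- The cylinder is taken at the first level `n` with `2 · 2⁻ⁿ < r`; minimality gives `r / 4 ≤ 2⁻ⁿ`.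
At `n = 0` nothing precedes, and there `r ≤ 4` is what is needed. -/
theorem le_volume_fatCantor_inter_ball {x r : ℝ} (hx : x ∈ fatCantor) (hr : 0 < r) (hr4 : r ≤ 4) :
    ENNReal.ofReal (r / 4) ≤ volume (fatCantor ∩ Metric.ball x r) := by
  classical
  obtain ⟨e, rfl⟩ := hx
  have hex : ∃ n : ℕ, 2 * (1 / 2 : ℝ) ^ n < r := by
    obtain ⟨n, hn⟩ := exists_pow_lt_of_lt_one (half_pos hr) (show (1 / 2 : ℝ) < 1 by norm_num)
    exact ⟨n, by linarith⟩
  have hspec := Nat.find_spec hex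
  have hle : r / 4 ≤ (1 / 2) ^ Nat.find hex := by
    rcases Nat.eq_zero_or_pos (Nat.find hex) with h0 | h0
    · rw [h0]; norm_num; linarith
    · obtain ⟨k, hk⟩ := Nat.exists_eq_succ_of_ne_zero h0.ne'
      have := Nat.find_min hex (m := k) (by omega)
      rw [hk, pow_succ]
      linarith
  refine (ENNReal.ofReal_le_ofReal hle).trans
    ((le_volume_fatCantor_inter_closedBall e _).trans (measure_mono ?_))
  exact inter_subset_inter_right _ (Metric.closedBall_subset_ball hspec)

theorem volume_fatCantor_pos : 0 < volume fatCantor := by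
  obtain ⟨x, hx⟩ := isCantorSet_fatCantor.nonempty
  refine lt_of_lt_of_le ?_ ((le_volume_fatCantor_inter_ball hx (r := 1) (by norm_num)
    (by norm_num)).trans (measure_mono inter_subset_left))
  simp

end Cantor

/-! ### Vanishing energy on compact totally disconnected spaces -/

section TotallyDisconnected

variable {X : Type u} [MetricSpace X]

theorem slope_eq_zero_of_isLocallyConstant {f : X → ℝ} (hf : IsLocallyConstant f) (x : X) :
    slope f x = 0 := by
  refine le_antisymm (limsup_le_of_le (by isBoundedDefault) ?_) zero_le
  filter_upwards [nhdsWithin_le_nhds ((IsLocallyConstant.iff_eventually_eq f).1 hf x)] with y hy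
  simp [hy]

theorem isBddSuppLipschitz_of_isLocallyConstant [CompactSpace X] {f : X → ℝ}
    (hf : IsLocallyConstant f) : IsBddSuppLipschitz f := by
  refine ⟨?_, isCompact_univ.isBounded.subset (subset_univ _)⟩
  -- A Lebesgue number of the open cover by fibres makes `f` constant at scale `δ`; pairs farther
  -- apart are handled by the bound `2M`, whence the Lipschitz constant `2M / δ`.
  obtain ⟨δ, hδ, hball⟩ : ∃ δ > 0, ∀ x y : X, dist x y < δ → f x = f y := by
    obtain ⟨δ, hδ, h⟩ := lebesgue_number_lemma_of_metric (isCompact_univ (X := X))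
      (c := fun t : ℝ => f ⁻¹' {t}) (fun t => hf.isOpen_fiber t)
      (fun x _ => mem_iUnion.2 ⟨f x, rfl⟩)
    refine ⟨δ, hδ, fun x y hxy => ?_⟩
    obtain ⟨t, ht⟩ := h y (mem_univ y)
    have h1 : f x = t := ht (Metric.mem_ball.2 hxy)
    have h2 : f y = t := ht (Metric.mem_ball_self hδ)
    rw [h1, h2]
  obtain ⟨M, hM⟩ := (isCompact_range hf.continuous).isBounded.exists_norm_le
  refine ⟨(2 * M / δ).toNNReal, LipschitzWith.of_dist_le_mul fun x y => ?_⟩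
  have hM' : ∀ x, |f x| ≤ M := fun x => hM _ (mem_range_self x)
  have hM0 : 0 ≤ M := (abs_nonneg _).trans (hM' x)
  rw [Real.coe_toNNReal _ (by positivity)]
  rcases lt_or_ge (dist x y) δ with h | h
  · rw [hball x y h, dist_self]
    positivity
  · calc dist (f x) (f y) ≤ 2 * M := by
          rw [Real.dist_eq]
          exact (abs_sub _ _).trans (by linarith [hM' x, hM' y])
      _ = 2 * M / δ * δ := by field_simp
      _ ≤ _ := by gcongr

variable [MeasurableSpace X] [BorelSpace X] [CompactSpace X] [TotallyDisconnectedSpace X]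
  (m : Measure X) [IsFiniteMeasure m]

/-- Continuous functions are dense in `L²`, and on a compact totally disconnected space they are
uniform limits of functions factoring through a finite discrete space. Finiteness of `m` turns
uniform closeness into `L²` closeness. -/
theorem exists_isLocallyConstant_approx (f : Lp ℝ 2 m) {ε : ℝ≥0∞} (hε : ε ≠ 0) :
    ∃ w : X → ℝ, IsLocallyConstant w ∧ eLpNorm (fun x => w x - f x) 2 m ≤ ε := by
  have hε2 : ε / 2 ≠ 0 := by simpa using hε
  obtain ⟨g, hg, -⟩ := (Lp.memLp f).exists_boundedContinuous_eLpNorm_sub_le (by simp) hε2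
  obtain ⟨δ, hδ0, hδ⟩ : ∃ δ : ℝ≥0, 0 < δ ∧ (δ : ℝ≥0∞) * m univ ^ (1 / 2 : ℝ) ≤ ε / 2 := by
    have htop : m univ ^ (1 / 2 : ℝ) ≠ ⊤ := ENNReal.rpow_ne_top_of_nonneg (by norm_num)
      (measure_ne_top m univ)
    obtain ⟨δ, hδ0, hδ⟩ := ENNReal.exists_nnreal_pos_mul_lt htop hε2
    exact ⟨δ, hδ0, hδ.le⟩
  set S : Set (ℝ × ℝ) := {p | dist p.1 p.2 < δ}
  have hS : S ∈ nhdsSet (diagonal ℝ) := by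
    refine (isOpen_lt (by fun_prop) (by fun_prop)).mem_nhdsSet.2 ?_
    rintro ⟨x, y⟩ (rfl : x = y)
    simpa [S] using hδ0
  obtain ⟨n, k, h, hk, hkh⟩ :=
    ContinuousMap.exists_finite_approximation_of_mem_nhds_diagonal g.toContinuousMap hS
  have hloc : IsLocallyConstant fun x => h (k x) :=
    ((IsLocallyConstant.iff_continuous k).2 hk).comp h
  refine ⟨fun x => h (k x), hloc, ?_⟩
  have h1 : eLpNorm (fun x => h (k x) - g x) 2 m ≤ ε / 2 := by
    refine le_trans (eLpNorm_le_of_ae_bound (C := (δ : ℝ)) (ae_of_all _ fun x => ?_)) ?_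
    · have := hkh x
      simp only [S, mem_ofPred_eq] at this
      rw [dist_comm, Real.dist_eq] at this
      exact this.le
    · refine le_trans (le_of_eq ?_) hδ
      rw [mul_comm, ENNReal.ofReal_coe_nnreal, ENNReal.toReal_ofNat, one_div]
  have h2 : eLpNorm (fun x => g x - f x) 2 m ≤ ε / 2 := by
    rw [← eLpNorm_neg]
    convert hg using 2
    ext x
    simp
  calc eLpNorm (fun x => h (k x) - f x) 2 m
      = eLpNorm ((fun x => h (k x) - g x) + fun x => g x - f x) 2 m := by
        congr 1; ext x; simp
    _ ≤ _ := eLpNorm_add_le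
        (hloc.continuous.sub g.continuous).aestronglyMeasurable
        (g.continuous.aestronglyMeasurable.sub (Lp.aestronglyMeasurable f)) (by norm_num)
    _ ≤ ε / 2 + ε / 2 := add_le_add h1 h2
    _ = ε := ENNReal.add_halves ε

theorem exists_isApproxSeq_slopeEnergy_eq_zero (f : Lp ℝ 2 m) :
    ∃ w : ℕ → X → ℝ, IsApproxSeq m f w ∧ ∀ n, slopeEnergy m (w n) = 0 := by
  have h : ∀ n : ℕ, ((n : ℝ≥0∞) + 1)⁻¹ ≠ 0 := fun n => by simp
  choose w hw hwf using fun n => exists_isLocallyConstant_approx m f (h n)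
  refine ⟨w, ⟨fun n => isBddSuppLipschitz_of_isLocallyConstant (hw n), ?_⟩, fun n => ?_⟩
  · refine tendsto_of_tendsto_of_tendsto_of_le_of_le tendsto_const_nhds ?_
      (fun _ => zero_le) hwf
    simpa using (tendsto_add_atTop_iff_nat 1).2 ENNReal.tendsto_inv_nat_nhds_zero
  · simp [slopeEnergy, slope_eq_zero_of_isLocallyConstant (hw n)]

theorem sobolevSpace_eq_top : sobolevSpace m = ⊤ := by
  refine eq_top_iff.2 fun f _ => ?_
  obtain ⟨w, hw, h0⟩ := exists_isApproxSeq_slopeEnergy_eq_zero m f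
  exact ⟨w, hw, by simp [h0]⟩

theorem sobolevNorm_eq_norm (f : sobolevSpace m) : sobolevNorm m f = ‖(f : Lp ℝ 2 m)‖ := by
  obtain ⟨w, hw, h0⟩ := exists_isApproxSeq_slopeEnergy_eq_zero m (f : Lp ℝ 2 m)
  have : relaxedEnergy m (f : Lp ℝ 2 m) = 0 := by
    refine le_antisymm ?_ zero_le
    refine (iInf₂_le w hw).trans ?_
    simp [h0]
  rw [sobolevNorm, this]
  simp

theorem isInfinitesimallyHilbertian_of_totallyDisconnected : IsInfinitesimallyHilbertian m := by
  -- The inner product is that of `L²`, restricted to the subspace.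
  refine ⟨InnerProductSpace.toCore, fun f => ?_⟩
  rw [sobolevNorm_eq_norm]
  exact real_inner_self_eq_norm_sq f

end TotallyDisconnected

/-! ### The space `C × C`: regularity, rectifiability, support -/

section Square

theorem isCompact_square {C : Set ℝ} (hC : IsCompact C) :
    IsCompact {p : L1Plane | p.fst ∈ C ∧ p.snd ∈ C} := by
  convert (hC.prod hC).image toL1Plane.continuous
  ext p
  constructor
  · intro hp
    exact ⟨WithLp.ofLp p, hp, rfl⟩
  · rintro ⟨q, hq, rfl⟩
    exact hq

theorem compactSpace_square {C : Set ℝ} (hC : IsCompact C) : CompactSpace (Square C) :=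
  isCompact_iff_compactSpace.1 (isCompact_square hC)

theorem totallyDisconnectedSpace_square {C : Set ℝ} (hC : IsTotallyDisconnected C) :
    TotallyDisconnectedSpace (Square C) := by
  have : TotallyDisconnectedSpace C := totallyDisconnectedSpace_subtype_iff.2 hC
  let f : Square C → C × C := fun p => (⟨p.1.fst, p.2.1⟩, ⟨p.1.snd, p.2.2⟩)
  have hf : Continuous f := by
    refine Continuous.prodMk (Continuous.subtype_mk ?_ _) (Continuous.subtype_mk ?_ _)
    · exact (WithLp.continuous_fst 1 ℝ ℝ).comp continuous_subtype_val
    · exact (WithLp.continuous_snd 1 ℝ ℝ).comp continuous_subtype_val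
  have hinj : Function.Injective f := by
    intro p q h
    simp only [f, Prod.mk.injEq, Subtype.mk.injEq] at h
    exact Subtype.ext (WithLp.ofLp_injective 1 (Prod.ext h.1 h.2))
  exact ⟨isTotallyDisconnected_of_image hf.continuousOn hinj
    (isTotallyDisconnected_of_totallyDisconnectedSpace _)⟩

theorem measurableSet_square {C : Set ℝ} (hC : IsCompact C) :
    MeasurableSet {p : L1Plane | p.fst ∈ C ∧ p.snd ∈ C} := (isCompact_square hC).measurableSet

theorem map_val_squareMeasure {C : Set ℝ} (hC : IsCompact C) :
    (squareMeasure C).map Subtype.val =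
      lebesgue.restrict {p : L1Plane | p.fst ∈ C ∧ p.snd ∈ C} :=
  map_comap_subtype_coe (measurableSet_square hC) lebesgue

theorem squareMeasure_apply {C : Set ℝ} (hC : IsCompact C) (s : Set (Square C)) :
    squareMeasure C s = lebesgue (Subtype.val '' s) :=
  comap_subtype_coe_apply (measurableSet_square hC) lebesgue s

theorem squareMeasure_ball {C : Set ℝ} (hC : IsCompact C) (x : Square C) (r : ℝ) :
    squareMeasure C (Metric.ball x r) =
      lebesgue ({p : L1Plane | p.fst ∈ C ∧ p.snd ∈ C} ∩ Metric.ball x.1 r) := by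
  rw [squareMeasure_apply hC]
  congr 1
  ext p
  constructor
  · rintro ⟨q, hq, rfl⟩
    exact ⟨q.2, hq⟩
  · rintro ⟨hp, hb⟩
    exact ⟨⟨p, hp⟩, hb, rfl⟩

theorem isFiniteMeasure_squareMeasure {C : Set ℝ} (hC : IsCompact C) :
    IsFiniteMeasure (squareMeasure C) := by
  refine ⟨?_⟩
  rw [squareMeasure_apply hC]
  refine lebesgue_lt_top ((isCompact_square hC).isBounded.subset ?_)
  rintro _ ⟨q, -, rfl⟩
  exact q.2

theorem isMetricMeasureSpace_square {C : Set ℝ} (hC : IsCompact C) :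
    IsMetricMeasureSpace (squareMeasure C) := by
  have := compactSpace_square hC
  have := isFiniteMeasure_squareMeasure hC
  exact ⟨inferInstance, inferInstance, fun s _ => measure_lt_top _ s⟩

/-- An `ℓ¹` ball of radius `r` contains the product of intervals of radius `r / 2` and lies in the
product of intervals of radius `r`. The lower bound `(r / 8)²` fixes the constant `64`; the upper
bound is `4 r²`. -/
theorem isAhlforsRegular_square : IsAhlforsRegular (squareMeasure fatCantor) 2 := by
  refine ⟨by norm_num, 64, by norm_num, fun x r hr hdiam => ?_⟩
  -- As `C ⊆ [0, 2]`, the `ℓ¹` diameter is at most `4`, within the range of the one-dimensional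
  -- volume bound.
  have hr4 : r < 4 := by
    have h : Metric.ediam (univ : Set (Square fatCantor)) ≤ ENNReal.ofReal 4 := by
      refine Metric.ediam_le fun p _ q _ => ?_
      rw [edist_dist]
      refine ENNReal.ofReal_le_ofReal ?_
      rw [Subtype.dist_eq, L1Plane.dist_def]
      have h1 := fatCantor_subset_Icc p.2.1
      have h2 := fatCantor_subset_Icc p.2.2
      have h3 := fatCantor_subset_Icc q.2.1
      have h4 := fatCantor_subset_Icc q.2.2
      have h5 : |p.1.fst - q.1.fst| ≤ 2 := abs_le.2 ⟨by linarith [h1.1, h3.2], by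
        linarith [h1.2, h3.1]⟩
      have h6 : |p.1.snd - q.1.snd| ≤ 2 := abs_le.2 ⟨by linarith [h2.1, h4.2], by
        linarith [h2.2, h4.1]⟩
      linarith
    exact (ENNReal.ofReal_lt_ofReal_iff (by norm_num)).1 (hdiam.trans_le h)
  rw [squareMeasure_ball isCompact_fatCantor]
  have hcast : r ^ (2 : ℝ) = r ^ 2 := by norm_cast
  rw [hcast]
  constructor
  · have h1 := le_volume_fatCantor_inter_ball x.2.1 (half_pos hr) (by linarith)
    have h2 := le_volume_fatCantor_inter_ball x.2.2 (half_pos hr) (by linarith)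
    calc ENNReal.ofReal (64⁻¹ * r ^ 2)
        = ENNReal.ofReal (r / 2 / 4) * ENNReal.ofReal (r / 2 / 4) := by
          rw [← ENNReal.ofReal_mul (by positivity)]; congr 1; ring
      _ ≤ _ := mul_le_mul' h1 h2
      _ = _ := (lebesgue_prod _ _).symm
      _ ≤ _ := by
        refine measure_mono fun p hp => ⟨⟨hp.1.1, hp.2.1⟩, ?_⟩
        have h3 := hp.1.2
        have h4 := hp.2.2
        rw [Metric.mem_ball, Real.dist_eq] at h3 h4
        rw [Metric.mem_ball, L1Plane.dist_def]
        linarith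
  · calc _ ≤ lebesgue {p : L1Plane | p.fst ∈ Metric.ball x.1.fst r ∧
          p.snd ∈ Metric.ball x.1.snd r} := by
          refine measure_mono fun p hp => ?_
          have h := hp.2
          rw [Metric.mem_ball, L1Plane.dist_def] at h
          constructor <;> rw [Metric.mem_ball, Real.dist_eq]
          · linarith [abs_nonneg (p.snd - x.1.snd)]
          · linarith [abs_nonneg (p.fst - x.1.fst)]
      _ = ENNReal.ofReal (2 * r) * ENNReal.ofReal (2 * r) := by
          rw [lebesgue_prod, Real.volume_ball, Real.volume_ball]
      _ ≤ _ := by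
          rw [← ENNReal.ofReal_mul (by positivity)]
          refine ENNReal.ofReal_le_ofReal ?_
          nlinarith [sq_nonneg r]

/-- The identity from the plane with the `ℓ¹` norm to the Euclidean plane. -/
noncomputable def toEuclideanPlane (p : L1Plane) : EuclideanSpace ℝ (Fin 2) := !₂[p.fst, p.snd]

theorem dist_toEuclideanPlane (p q : L1Plane) :
    2⁻¹ * dist p q ≤ dist (toEuclideanPlane p) (toEuclideanPlane q) ∧
      dist (toEuclideanPlane p) (toEuclideanPlane q) ≤ 2 * dist p q := by
  have h : dist (toEuclideanPlane p) (toEuclideanPlane q) =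
      √((p.fst - q.fst) ^ 2 + (p.snd - q.snd) ^ 2) := by
    rw [EuclideanSpace.dist_eq]
    simp [toEuclideanPlane, Real.dist_eq, Fin.sum_univ_two]
  rw [h, L1Plane.dist_def, ← sq_abs (p.fst - q.fst), ← sq_abs (p.snd - q.snd)]
  have h1 := abs_nonneg (p.fst - q.fst)
  have h2 := abs_nonneg (p.snd - q.snd)
  constructor
  · refine Real.le_sqrt_of_sq_le ?_
    nlinarith [sq_nonneg (|p.fst - q.fst| - |p.snd - q.snd|)]
  · refine Real.sqrt_le_iff.2 ⟨by positivity, by nlinarith⟩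

/-- Passing from the `ℓ¹` to the sup distance is a contraction, and for the sup distance the
two-dimensional Hausdorff measure is Lebesgue measure. -/
theorem squareMeasure_absolutelyContinuous_hausdorffMeasure {C : Set ℝ} (hC : IsCompact C) :
    squareMeasure C ≪ Measure.hausdorffMeasure ((2 : ℕ) : ℝ) := by
  intro s hs
  rw [squareMeasure_apply hC, lebesgue_apply, ← hausdorffMeasure_prod_real]
  have hLip : LipschitzWith 1 fun p : Square C => WithLp.ofLp p.1 := by
    refine LipschitzWith.of_dist_le_mul fun p q => ?_
    rw [Subtype.dist_eq, L1Plane.dist_def, Prod.dist_eq, NNReal.coe_one, one_mul]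
    have h1 := abs_nonneg (p.1.fst - q.1.fst)
    have h2 := abs_nonneg (p.1.snd - q.1.snd)
    refine max_le ?_ ?_ <;> rw [Real.dist_eq]
    · exact le_add_of_nonneg_right h2
    · exact le_add_of_nonneg_left h1
  have h := hLip.hausdorffMeasure_image_le (d := 2) (by norm_num) s
  have hs' : Measure.hausdorffMeasure (2 : ℝ) s = 0 := by exact_mod_cast hs
  rw [hs', mul_zero] at h
  refine measure_mono_null ?_ (le_antisymm h zero_le)
  rintro p ⟨q, hq, hqp⟩
  exact ⟨q, hq, congrArg WithLp.ofLp hqp⟩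

theorem isRectifiable_square {C : Set ℝ} (hC : IsCompact C) : IsRectifiable (squareMeasure C) := by
  -- One global chart suffices; the others are empty.
  refine ⟨fun _ => 2, fun i => if i = 0 then univ else ∅, fun _ p => toEuclideanPlane p.1,
    fun i => ⟨?_, ?_, 2, by norm_num, fun x _ y _ => dist_toEuclideanPlane x.1 y.1⟩, ?_, ?_⟩
  · dsimp only
    split_ifs <;> simp
  · exact Measure.absolutelyContinuous_of_le Measure.restrict_le_self |>.trans
      (squareMeasure_absolutelyContinuous_hausdorffMeasure hC)
  · intro i j hij
    by_cases hi : i = 0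
    · have hj : j ≠ 0 := fun h => hij (hi.trans h.symm)
      simp [hj]
    · simp [hi]
  · have : (⋃ i : ℕ, if i = 0 then (univ : Set (Square C)) else ∅) = univ :=
      eq_univ_of_forall fun x => mem_iUnion.2 ⟨0, by simp⟩
    rw [this]
    simp

theorem mem_support_squareMeasure (x : Square fatCantor) :
    x ∈ (squareMeasure fatCantor).support := by
  rw [Measure.mem_support_iff_forall]
  intro U hU
  obtain ⟨δ, hδ, hU⟩ := Metric.mem_nhds_iff.1 hU
  have hδ' : 0 < min δ 1 := by positivity
  refine lt_of_lt_of_le ?_ (measure_mono ((Metric.ball_subset_ball (min_le_left δ 1)).trans hU))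
  rw [squareMeasure_ball isCompact_fatCantor]
  have h1 := le_volume_fatCantor_inter_ball x.2.1 (half_pos hδ') (by linarith [min_le_right δ 1])
  have h2 := le_volume_fatCantor_inter_ball x.2.2 (half_pos hδ') (by linarith [min_le_right δ 1])
  have h3 : 0 < ENNReal.ofReal (min δ 1 / 2 / 4) := ENNReal.ofReal_pos.2 (by positivity)
  have h4 : 0 < lebesgue {p : L1Plane | p.fst ∈ fatCantor ∩ Metric.ball x.1.fst (min δ 1 / 2) ∧
      p.snd ∈ fatCantor ∩ Metric.ball x.1.snd (min δ 1 / 2)} := by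
    rw [lebesgue_prod]
    exact ENNReal.mul_pos (h3.trans_le h1).ne' (h3.trans_le h2).ne'
  refine h4.trans_le (measure_mono fun p hp => ⟨⟨hp.1.1, hp.2.1⟩, ?_⟩)
  have h3 := hp.1.2
  have h4 := hp.2.2
  rw [Metric.mem_ball, Real.dist_eq] at h3 h4
  rw [Metric.mem_ball, L1Plane.dist_def]
  linarith

end Square

/-! ### Blow-ups at density points -/

section Density

/-- `p` is a Lebesgue density point of `E`. -/
def IsDensityPoint (E : Set L1Plane) (p : L1Plane) : Prop :=
  Tendsto (fun r => lebesgue (Eᶜ ∩ Metric.closedBall p r) / lebesgue (Metric.closedBall p r))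
    (𝓝[>] 0) (𝓝 0)

theorem ae_isDensityPoint_square {C : Set ℝ} (hC : IsCompact C) :
    ∀ᵐ x ∂(squareMeasure C), IsDensityPoint {p : L1Plane | p.fst ∈ C ∧ p.snd ∈ C} x.1 := by
  -- The density theorem is applied to the complement, whose density is `0` at almost every point of
  -- the square.
  have h := Besicovitch.ae_tendsto_measure_inter_div_of_measurableSet lebesgue
    (measurableSet_square hC).compl
  have h2 : ∀ᵐ x ∂((squareMeasure C).map Subtype.val),
      IsDensityPoint {p : L1Plane | p.fst ∈ C ∧ p.snd ∈ C} x := by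
    rw [map_val_squareMeasure hC]
    filter_upwards [ae_restrict_of_ae h, ae_restrict_mem (measurableSet_square hC)] with x hx hxE
    have hxE' : x ∉ {p : L1Plane | p.fst ∈ C ∧ p.snd ∈ C}ᶜ := notMem_compl_iff.2 hxE
    rw [indicator_of_notMem hxE'] at hx
    exact hx
  exact ae_of_ae_map measurable_subtype_coe.aemeasurable h2

/-- The blow-up at `p` at scale `r`. -/
noncomputable def blowUp {C : Set ℝ} (p : Square C) (r : ℝ) (x : Square C) : L1Plane :=
  r⁻¹ • (x.1 - p.1)

variable {C : Set ℝ} {p : Square C}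

theorem blowUp_self (r : ℝ) : blowUp p r p = 0 := by simp [blowUp]

theorem continuous_blowUp (r : ℝ) : Continuous (blowUp p r) := by
  unfold blowUp
  fun_prop

theorem dist_blowUp {r : ℝ} (hr : 0 < r) (x y : Square C) :
    dist (blowUp p r x) (blowUp p r y) = r⁻¹ * dist x y := by
  rw [blowUp, blowUp, dist_smul₀, dist_sub_right, Subtype.dist_eq,
    Real.norm_of_nonneg (by positivity)]

/-- The ball of radius `R r_k` has measure a fixed multiple of `r_k²`, so density says that the
complement occupies `o(r_k²)` of it. -/
theorem tendsto_lebesgue_compl_div {E : Set L1Plane} {q : L1Plane} (h : IsDensityPoint E q)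
    {r : ℕ → ℝ} (hr : ∀ k, 0 < r k) (hr0 : Tendsto r atTop (𝓝 0)) {R : ℝ} (hR : 0 < R) :
    Tendsto (fun k => lebesgue.real (Eᶜ ∩ Metric.closedBall q (R * r k)) / r k ^ 2)
      atTop (𝓝 0) := by
  have h1 : Tendsto (fun k => R * r k) atTop (𝓝[>] 0) := by
    refine tendsto_nhdsWithin_iff.2 ⟨by simpa using hr0.const_mul R, ?_⟩
    exact Eventually.of_forall fun k => mul_pos hR (hr k)
  have h2 := (ENNReal.tendsto_toReal ENNReal.zero_ne_top).comp (h.comp h1)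
  have h3 := h2.mul_const (R ^ 2 * lebesgue.real (Metric.ball 0 1))
  rw [ENNReal.toReal_zero, zero_mul] at h3
  refine h3.congr fun k => ?_
  have hk := hr k
  have hpos : 0 < lebesgue.real (Metric.ball 0 1) :=
    ENNReal.toReal_pos lebesgue_unitBall_pos.ne' lebesgue_unitBall_ne_top
  simp only [Function.comp_apply]
  rw [lebesgue_closedBall q (by positivity), ENNReal.toReal_div, ENNReal.toReal_mul,
    ENNReal.toReal_ofReal (by positivity)]
  simp only [← measureReal_def]
  field_simp

theorem lebesgue_real_ball (x : L1Plane) {r : ℝ} (hr : 0 ≤ r) :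
    lebesgue.real (Metric.ball x r) = r ^ 2 * lebesgue.real (Metric.ball 0 1) := by
  rw [measureReal_def, lebesgue_ball x hr, ENNReal.toReal_mul,
    ENNReal.toReal_ofReal (by positivity), measureReal_def]

/-- Blow-ups of a set at a density point become dense on bounded sets. -/
theorem eventually_exists_dist_blowUp_lt
    (h : IsDensityPoint {p : L1Plane | p.fst ∈ C ∧ p.snd ∈ C} p.1)
    {r : ℕ → ℝ} (hr : ∀ k, 0 < r k) (hr0 : Tendsto r atTop (𝓝 0)) {R δ : ℝ} (hR : 0 < R)
    (hδ : 0 < δ) :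
    ∀ᶠ k in atTop, ∀ v ∈ Metric.ball (0 : L1Plane) R, ∃ x, dist (blowUp p (r k) x) v < δ := by
  have hpos : 0 < lebesgue.real (Metric.ball 0 1) :=
    ENNReal.toReal_pos lebesgue_unitBall_pos.ne' lebesgue_unitBall_ne_top
  filter_upwards [(tendsto_lebesgue_compl_div h hr hr0 (add_pos hR hδ)).eventually_lt_const
    (show 0 < δ ^ 2 * lebesgue.real (Metric.ball 0 1) by positivity)] with k hk v hv
  -- If the blow-up misses the `δ`-ball about `v`, the complement contains a ball of radius `δ r_k`
  -- near `p`, of measure `δ² r_k²` times that of the unit ball. That is too much at a density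
  -- point.
  by_contra! hcon
  have hrk := hr k
  have hsub : Metric.ball (p.1 + r k • v) (δ * r k) ⊆
      {p : L1Plane | p.fst ∈ C ∧ p.snd ∈ C}ᶜ ∩ Metric.closedBall p.1 ((R + δ) * r k) := by
    intro y hy
    rw [Metric.mem_ball] at hy
    constructor
    · intro hyE
      have h1 := hcon ⟨y, hyE⟩
      have h2 : dist (blowUp p (r k) ⟨y, hyE⟩) v = (r k)⁻¹ * dist y (p.1 + r k • v) := by
        have : v = (r k)⁻¹ • (p.1 + r k • v - p.1) := by
          rw [add_sub_cancel_left, smul_smul, inv_mul_cancel₀ hrk.ne', one_smul]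
        conv_lhs => rw [this]
        rw [blowUp, dist_smul₀, dist_sub_right, Real.norm_of_nonneg (by positivity)]
      rw [h2] at h1
      have : (r k)⁻¹ * dist y (p.1 + r k • v) < (r k)⁻¹ * (δ * r k) := by gcongr
      have h3 : (r k)⁻¹ * (δ * r k) = δ := by field_simp
      linarith
    · rw [Metric.mem_closedBall]
      have h1 : dist (p.1 + r k • v) p.1 ≤ R * r k := by
        rw [dist_eq_norm, add_sub_cancel_left, norm_smul, Real.norm_of_nonneg hrk.le, mul_comm]
        rw [mem_ball_zero_iff] at hv
        gcongr
      linarith [dist_triangle y (p.1 + r k • v) p.1]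
  have hle : lebesgue.real (Metric.ball (p.1 + r k • v) (δ * r k)) ≤ _ :=
    measureReal_mono hsub (lebesgue_lt_top
      (Metric.isBounded_closedBall.subset inter_subset_right)).ne
  rw [lebesgue_real_ball _ (by positivity)] at hle
  rw [div_lt_iff₀ (by positivity)] at hk
  nlinarith

theorem setIntegral_blowUp_plane (q : L1Plane) {r R : ℝ} (hr : 0 < r) (f : L1Plane → ℝ) :
    ∫ y in Metric.ball q (R * r), f (r⁻¹ • (y - q)) ∂lebesgue =
      r ^ 2 * ∫ y in Metric.ball 0 R, f y ∂lebesgue := by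
  have hfin : Module.finrank ℝ L1Plane = 2 := by
    rw [← toL1Plane.toLinearEquiv.finrank_eq]; simp
  rw [← integral_indicator Metric.isOpen_ball.measurableSet,
    ← integral_indicator Metric.isOpen_ball.measurableSet]
  have h1 := integral_sub_right_eq_self (μ := lebesgue)
    (fun y => (Metric.ball (0 : L1Plane) R).indicator f (r⁻¹ • y)) q
  have h2 := Measure.integral_comp_inv_smul lebesgue ((Metric.ball (0 : L1Plane) R).indicator f) r
  rw [hfin, abs_of_nonneg (by positivity), smul_eq_mul] at h2
  rw [← h2, ← h1]
  congr 1
  ext y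
  have hiff : y ∈ Metric.ball q (R * r) ↔ r⁻¹ • (y - q) ∈ Metric.ball (0 : L1Plane) R := by
    rw [mem_ball_zero_iff, norm_smul, Real.norm_of_nonneg (by positivity), Metric.mem_ball,
      dist_eq_norm, inv_mul_lt_iff₀ hr, mul_comm]
  by_cases hy : y ∈ Metric.ball q (R * r)
  · rw [indicator_of_mem hy, indicator_of_mem (hiff.1 hy)]
  · rw [indicator_of_notMem hy, indicator_of_notMem (fun h => hy (hiff.2 h))]

theorem setIntegral_square_ball (hC : IsCompact C) (R : ℝ) {F : L1Plane → ℝ} :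
    ∫ x in Metric.ball p R, F x.1 ∂(squareMeasure C) =
      ∫ y in {p : L1Plane | p.fst ∈ C ∧ p.snd ∈ C} ∩ Metric.ball p.1 R, F y ∂lebesgue := by
  have hE := measurableSet_square hC
  have h := MeasurableEmbedding.subtype_coe hE
  rw [inter_comm, ← Measure.restrict_restrict Metric.isOpen_ball.measurableSet,
    ← map_val_squareMeasure hC]
  exact (h.setIntegral_map (μ := squareMeasure C) F (Metric.ball p.1 R)).symm

/-- After a change of variables with Jacobian `r²`, the two integrals differ only by the part of the
ball outside `C × C`, where `f` is bounded by `M`. -/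
theorem abs_setIntegral_blowUp_sub_le (hC : IsCompact C) {r R : ℝ} (hr : 0 < r)
    {f : L1Plane → ℝ} (hf : Measurable f) {M : ℝ} (hM : ∀ y, |f y| ≤ M) :
    |(∫ x in Metric.ball p (R * r), f (blowUp p r x) ∂(squareMeasure C)) / r ^ 2 -
        ∫ y in Metric.ball 0 R, f y ∂lebesgue| ≤
      M * (lebesgue.real ({p : L1Plane | p.fst ∈ C ∧ p.snd ∈ C}ᶜ ∩
        Metric.closedBall p.1 (R * r)) / r ^ 2) := by
  set E := {p : L1Plane | p.fst ∈ C ∧ p.snd ∈ C}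
  have hE : MeasurableSet E := measurableSet_square hC
  set F : L1Plane → ℝ := fun y => f (r⁻¹ • (y - p.1))
  have hF : Measurable F := hf.comp (by fun_prop)
  have h1 : ∫ x in Metric.ball p (R * r), f (blowUp p r x) ∂(squareMeasure C) =
      ∫ y in E ∩ Metric.ball p.1 (R * r), F y ∂lebesgue :=
    setIntegral_square_ball (F := F) hC _
  have h2 := setIntegral_blowUp_plane p.1 (R := R) hr f
  have hint : IntegrableOn F (Metric.ball p.1 (R * r)) lebesgue :=
    Measure.integrableOn_of_bounded (M := M) (lebesgue_lt_top Metric.isBounded_ball).ne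
      hF.aestronglyMeasurable (ae_of_all _ fun y => hM _)
  have h3 := integral_inter_add_sdiff (f := F) (s := Metric.ball p.1 (R * r)) hE hint
  have h4 : |∫ y in Metric.ball p.1 (R * r) \ E, F y ∂lebesgue| ≤
      M * lebesgue.real (Eᶜ ∩ Metric.closedBall p.1 (R * r)) := by
    have hsub : Metric.ball p.1 (R * r) \ E ⊆ Eᶜ ∩ Metric.closedBall p.1 (R * r) :=
      fun y hy => ⟨hy.2, Metric.ball_subset_closedBall hy.1⟩
    have hfin : lebesgue (Eᶜ ∩ Metric.closedBall p.1 (R * r)) < ⊤ :=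
      lebesgue_lt_top (Metric.isBounded_closedBall.subset inter_subset_right)
    have := norm_setIntegral_le_of_norm_le_const (f := F) (C := M) (μ := lebesgue)
      ((measure_mono hsub).trans_lt hfin) (fun y _ => hM _)
    refine this.trans ?_
    have hM0 : 0 ≤ M := (abs_nonneg _).trans (hM 0)
    gcongr
    exact hfin.ne
  rw [h1, inter_comm]
  have h5 : (∫ y in Metric.ball p.1 (R * r) ∩ E, F y ∂lebesgue) / r ^ 2 -
      ∫ y in Metric.ball 0 R, f y ∂lebesgue =
      -((∫ y in Metric.ball p.1 (R * r) \ E, F y ∂lebesgue) / r ^ 2) := by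
    rw [h2] at h3
    rw [eq_sub_of_add_eq h3]
    field_simp
    ring
  rw [h5, abs_neg, abs_div, abs_of_pos (show 0 < r ^ 2 by positivity), ← mul_div_assoc]
  gcongr

theorem tendsto_setIntegral_blowUp_div (hC : IsCompact C)
    (h : IsDensityPoint {p : L1Plane | p.fst ∈ C ∧ p.snd ∈ C} p.1)
    {r : ℕ → ℝ} (hr : ∀ k, 0 < r k) (hr0 : Tendsto r atTop (𝓝 0)) {R : ℝ} (hR : 0 < R)
    {f : L1Plane → ℝ} (hf : Measurable f) {M : ℝ} (hM : ∀ y, |f y| ≤ M) :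
    Tendsto (fun k => (∫ x in Metric.ball p (R * r k), f (blowUp p (r k) x) ∂(squareMeasure C)) /
      r k ^ 2) atTop (𝓝 (∫ y in Metric.ball 0 R, f y ∂lebesgue)) := by
  rw [tendsto_iff_dist_tendsto_zero]
  refine squeeze_zero (fun _ => dist_nonneg)
    (fun k => abs_setIntegral_blowUp_sub_le hC (hr k) hf hM) ?_
  simpa using (tendsto_lebesgue_compl_div h hr hr0 hR).const_mul M

/-- The normalised blow-ups of the measure at a density point converge. -/
theorem tendsto_setIntegral_blowUp (hC : IsCompact C)
    (h : IsDensityPoint {p : L1Plane | p.fst ∈ C ∧ p.snd ∈ C} p.1)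
    {r : ℕ → ℝ} (hr : ∀ k, 0 < r k) (hr0 : Tendsto r atTop (𝓝 0)) {R : ℝ} (hR : 0 < R)
    {f : L1Plane → ℝ} (hf : Measurable f) {M : ℝ} (hM : ∀ y, |f y| ≤ M) :
    Tendsto (fun k => ((squareMeasure C (Metric.ball p (r k)))⁻¹).toReal *
        ∫ x in Metric.ball p (R * r k), f (blowUp p (r k) x) ∂(squareMeasure C)) atTop
      (𝓝 (∫ y in Metric.ball 0 R, f y ∂normalisedLebesgue)) := by
  have h1 := tendsto_setIntegral_blowUp_div hC h hr hr0 hR hf hM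
  -- With `f = 1` and `R = 1` this is the limit of the normalising factor `m(B_{r_k}(p)) / r_k²`.
  have h2 := tendsto_setIntegral_blowUp_div hC h hr hr0 one_pos (f := fun _ => 1)
    measurable_const (M := 1) (by simp)
  have hpos : 0 < lebesgue.real (Metric.ball 0 1) :=
    ENNReal.toReal_pos lebesgue_unitBall_pos.ne' lebesgue_unitBall_ne_top
  simp only [one_mul, setIntegral_const, smul_eq_mul, mul_one] at h2
  have h3 := (h2.inv₀ hpos.ne').mul h1
  have hlim : ∫ y in Metric.ball 0 R, f y ∂normalisedLebesgue =
      (lebesgue.real (Metric.ball 0 1))⁻¹ * ∫ y in Metric.ball 0 R, f y ∂lebesgue := by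
    rw [normalisedLebesgue, Measure.restrict_smul, integral_smul_measure, ENNReal.toReal_inv,
      smul_eq_mul, measureReal_def]
  rw [hlim]
  refine h3.congr fun k => ?_
  have := hr k
  rw [ENNReal.toReal_inv, ← measureReal_def]
  field_simp

theorem integral_rescaled {X Y : Type*} [MetricSpace X] [MeasurableSpace X] [MeasurableSpace Y]
    [TopologicalSpace Y] [BorelSpace Y] (m : Measure X) (c : ℝ≥0∞) (s : Set X) {ψ : X → Y}
    (hψ : Measurable ψ) (f : Y →ᵇ ℝ) :
    ∫ y, f y ∂(c • (m.restrict s).map ψ) = c.toReal * ∫ x in s, f (ψ x) ∂m := by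
  rw [integral_smul_measure, integral_map hψ.aemeasurable
    f.continuous.measurable.aestronglyMeasurable, smul_eq_mul]

theorem tendsto_integral_map_blowUp (hC : IsCompact C)
    (h : IsDensityPoint {p : L1Plane | p.fst ∈ C ∧ p.snd ∈ C} p.1)
    {r : ℕ → ℝ} (hr : ∀ k, 0 < r k) (hr0 : Tendsto r atTop (𝓝 0)) {R : ℝ} (hR : 0 < R)
    (f : L1Plane →ᵇ ℝ) :
    Tendsto (fun k => ∫ y, f y ∂((squareMeasure C (Metric.ball p (r k)))⁻¹ •
        ((squareMeasure C).restrict (Metric.ball p (R * r k))).map (blowUp p (r k)))) atTop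
      (𝓝 (∫ y in Metric.ball 0 R, f y ∂normalisedLebesgue)) :=
  (tendsto_setIntegral_blowUp hC h hr hr0 hR f.continuous.measurable f.norm_coe_le_norm).congr
    fun k => (integral_rescaled _ _ _ (continuous_blowUp (p := p) (r k)).measurable f).symm

theorem abs_dist_sub_mul_dist_blowUp {r : ℝ} (hr : 0 < r) (x y : Square C) :
    |dist x y - r * dist (blowUp p r x) (blowUp p r y)| = 0 := by
  rw [dist_blowUp hr, mul_inv_cancel_left₀ hr.ne', sub_self, abs_zero]

theorem norm_blowUp {r : ℝ} (hr : 0 < r) (x : Square C) :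
    ‖blowUp p r x‖ = r⁻¹ * dist x p := by
  rw [← dist_blowUp (p := p) hr x p, blowUp_self, dist_zero_right]

/-- A point `x` whose image is within `ε` of `v` lies in the ball of radius `R r` automatically,
because blow-up norms are rescaled distances to `p`. -/
theorem ball_subset_thickening_blowUp {r R ε : ℝ} (hr : 0 < r)
    (h : ∀ v ∈ Metric.ball (0 : L1Plane) (R - ε), ∃ x, dist (blowUp p r x) v < ε) :
    Metric.ball (0 : L1Plane) (R - ε) ⊆
      Metric.thickening ε (blowUp p r '' Metric.ball p (R * r)) := by
  intro v hv
  obtain ⟨x, hx⟩ := h v hv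
  refine Metric.mem_thickening_iff.2 ⟨_, ⟨x, ?_, rfl⟩, by rwa [dist_comm]⟩
  rw [mem_ball_zero_iff] at hv
  have h2 := norm_le_norm_add_norm_sub' (blowUp p r x) v
  rw [norm_blowUp hr, ← dist_eq_norm] at h2
  rw [Metric.mem_ball, mul_comm, ← inv_mul_lt_iff₀ hr]
  linarith

/-- The blow-ups themselves serve as the maps `ψ`. They are exact dilations, so there is no
distortion, and every `R > 1` is admissible. -/
theorem rescalingsConverge_pointedL1Plane (hC : IsCompact C)
    (h : IsDensityPoint {p : L1Plane | p.fst ∈ C ∧ p.snd ∈ C} p.1)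
    {r : ℕ → ℝ} (hr : ∀ k, 0 < r k) (hr0 : Tendsto r atTop (𝓝 0)) :
    RescalingsConverge (squareMeasure C) p r pointedL1Plane := by
  intro ε hε hε1
  refine (ae_restrict_iff' measurableSet_Ioi).2 (ae_of_all _ fun R hR => ?_)
  have hR1 : (1 : ℝ) < R := hR
  obtain ⟨k₀, hk₀⟩ := eventually_atTop.1 (eventually_exists_dist_blowUp_lt h hr hr0
    (show 0 < R - ε by linarith) hε)
  refine ⟨k₀, fun k => blowUp p (r k), fun k hk => ⟨(continuous_blowUp _).measurable,
    blowUp_self _, fun x _ y _ => ?_, ball_subset_thickening_blowUp (hr k) (hk₀ k hk)⟩,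
    fun f _ => tendsto_integral_map_blowUp hC h hr hr0 (by linarith) f⟩
  exact (abs_dist_sub_mul_dist_blowUp (hr k) x y).trans_le (mul_pos hε (hr k)).le

theorem pointedL1Plane_mem_tangentCone (hC : IsCompact C)
    (h : IsDensityPoint {p : L1Plane | p.fst ∈ C ∧ p.snd ∈ C} p.1)
    (hp : p ∈ (squareMeasure C).support) :
    pointedL1Plane ∈ tangentCone (squareMeasure C) p := by
  have hpos : ∀ k : ℕ, (0 : ℝ) < 1 / ((k : ℝ) + 1) := fun k => Nat.one_div_pos_of_nat
  refine ⟨hp, fun k : ℕ => 1 / ((k : ℝ) + 1), hpos, fun i j hij =>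
    Nat.one_div_le_one_div hij, tendsto_one_div_add_atTop_nhds_zero_nat, ?_⟩
  exact rescalingsConverge_pointedL1Plane hC h hpos tendsto_one_div_add_atTop_nhds_zero_nat

end Density

/-! ### Uniqueness of pointed Gromov-Hausdorff limits -/

section GromovHausdorff

variable {X Z Y : Type*} [MetricSpace Z] [MetricSpace Y]

/-- The pairs `(φ x, ψ x)` with `φ x ∈ B_R(o)` form an `ε`-correspondence between the balls of
radius about `R` in the pointed spaces `(Z, o)` and `(Y, q)`. -/
structure IsAlmostIsometric (o : Z) (q : Y) (p : X) (φ : X → Z) (ψ : X → Y) (R ε : ℝ) : Prop where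
  left_point : φ p = o
  right_point : ψ p = q
  abs_dist_sub_le : ∀ x y, dist (φ x) o < R → dist (φ y) o < R →
    |dist (φ x) (φ y) - dist (ψ x) (ψ y)| ≤ ε
  left_dense : ∀ v, dist v o < R - 1 → ∃ x, dist (φ x) o < R ∧ dist (φ x) v < ε
  right_dense : ∀ y, dist y q < R - ε → ∃ x, dist (φ x) o < R ∧ dist y (ψ x) < ε

variable {ι : Type*} {U : Ultrafilter ι} {o : Z} {q : Y} {p : X} {φ : ι → X → Z} {ψ : ι → X → Y}
  {R ε : ι → ℝ}

/-- Points of `X` that `φ` sends close to a given point of `Z`. -/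
theorem exists_approx_section (hε : Tendsto ε U (𝓝 0)) (hR : Tendsto R U atTop)
    (h : ∀ᶠ i in U, IsAlmostIsometric o q p (φ i) (ψ i) (R i) (ε i)) :
    ∃ s : ι → Z → X, (∀ v, Tendsto (fun i => φ i (s i v)) U (𝓝 v)) ∧
      (∀ v, ∀ᶠ i in U, dist (φ i (s i v)) o < R i) ∧
      ∀ v, ∀ δ > 0, ∀ᶠ i in U, ∀ x, dist (φ i x) o < R i →
        |dist (ψ i x) (ψ i (s i v)) - dist (φ i x) v| < δ := by
  -- The section must be defined for all `i` and `v`; where no approximating point exists it takes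
  -- the irrelevant value `p`.
  have hex : ∀ i v, ∃ x : X, (∃ x', dist (φ i x') o < R i ∧ dist (φ i x') v < ε i) →
      dist (φ i x) o < R i ∧ dist (φ i x) v < ε i := by
    intro i v
    by_cases hx : ∃ x', dist (φ i x') o < R i ∧ dist (φ i x') v < ε i
    · exact ⟨hx.choose, fun _ => hx.choose_spec⟩
    · exact ⟨p, fun h => absurd h hx⟩
  choose s hs using hex
  have key : ∀ v, ∀ᶠ i in U, dist (φ i (s i v)) o < R i ∧ dist (φ i (s i v)) v < ε i := by
    intro v
    filter_upwards [h, hR.eventually_gt_atTop (dist v o + 1)] with i hi hRi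
    exact hs i v (hi.left_dense v (by linarith))
  refine ⟨s, fun v => ?_, fun v => (key v).mono fun i hi => hi.1, fun v δ hδ => ?_⟩
  · rw [tendsto_iff_dist_tendsto_zero]
    exact squeeze_zero' (Eventually.of_forall fun _ => dist_nonneg)
      ((key v).mono fun i hi => hi.2.le) hε
  · filter_upwards [h, key v, hε.eventually_lt_const (half_pos hδ)] with i hi hk hεi x hx
    have h1 := hi.abs_dist_sub_le x _ hx hk.1
    have h2 := abs_dist_sub_le (φ i (s i v)) v (φ i x)
    rw [dist_comm (φ i (s i v)), dist_comm v] at h2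
    rw [abs_le] at h1 h2
    rw [abs_lt]
    constructor <;> linarith [h1.1, h1.2, h2.1, h2.2, hk.2]

/-- A finite net of a slightly larger ball of `Z`, pushed to `Y` by one good correspondence, is a
net of the ball of `Y`. Thus balls of the complete space `Y` are totally bounded. -/
theorem properSpace_of_isAlmostIsometric [ProperSpace Z] [CompleteSpace Y]
    (hε : Tendsto ε U (𝓝 0)) (hR : Tendsto R U atTop)
    (h : ∀ᶠ i in U, IsAlmostIsometric o q p (φ i) (ψ i) (R i) (ε i)) : ProperSpace Y := by
  obtain ⟨s, -, -, hs⟩ := exists_approx_section hε hR h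
  have htb : ∀ M : ℝ, TotallyBounded (Metric.ball q M) := by
    intro M
    refine Metric.totallyBounded_iff.2 fun δ hδ => ?_
    have hδ4 : 0 < δ / 4 := by positivity
    obtain ⟨t, htfin, ht⟩ := Metric.totallyBounded_iff.1
      (isCompact_closedBall o (M + 1)).totallyBounded (δ / 4) hδ4
    have hall : ∀ᶠ i in U, ∀ v ∈ t, ∀ x, dist (φ i x) o < R i →
        |dist (ψ i x) (ψ i (s i v)) - dist (φ i x) v| < δ / 4 :=
      (eventually_all_finite htfin).2 fun v _ => hs v _ hδ4
    obtain ⟨i, hall, hi, hRi, hε1, hε2⟩ := (hall.and (h.and ((hR.eventually_gt_atTop (M + 1)).and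
      ((hε.eventually_lt_const hδ4).and (hε.eventually_lt_const one_half_pos))))).exists
    refine ⟨(fun v => ψ i (s i v)) '' t, htfin.image _, fun y hy => ?_⟩
    rw [Metric.mem_ball] at hy
    obtain ⟨x, hx, hyx⟩ := hi.right_dense y (by linarith)
    have hRpos : dist (φ i p) o < R i := by
      rw [hi.left_point, dist_self]
      exact lt_of_le_of_lt dist_nonneg hx
    have h1 := hi.abs_dist_sub_le x p hx hRpos
    rw [hi.left_point, hi.right_point, abs_le] at h1
    have h2 := dist_triangle_left (ψ i x) q y
    obtain ⟨v, hv, hxv⟩ := mem_iUnion₂.1 (ht (Metric.mem_closedBall.2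
      (show dist (φ i x) o ≤ M + 1 by linarith [h1.2])))
    rw [Metric.mem_ball] at hxv
    refine mem_iUnion₂.2 ⟨_, mem_image_of_mem _ hv, ?_⟩
    have h3 := hall v hv x hx
    rw [abs_lt] at h3
    have h4 := dist_triangle y (ψ i x) (ψ i (s i v))
    rw [Metric.mem_ball]
    linarith [h3.2]
  refine ⟨fun y r => isCompact_iff_totallyBounded_isComplete.2
    ⟨?_, Metric.isClosed_closedBall.isComplete⟩⟩
  refine (htb (r + dist y q + 1)).subset (Metric.closedBall_subset_ball' ?_)
  linarith

/-- Uniqueness of pointed Gromov-Hausdorff limits, along an ultrafilter. -/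
theorem exists_isometryEquiv_of_isAlmostIsometric [ProperSpace Z] [CompleteSpace Y]
    (hε : Tendsto ε U (𝓝 0)) (hR : Tendsto R U atTop)
    (h : ∀ᶠ i in U, IsAlmostIsometric o q p (φ i) (ψ i) (R i) (ε i)) :
    ∃ g : Z ≃ᵢ Y, g o = q ∧ ∀ M δ : ℝ, 0 < δ → ∀ᶠ i in U, ∀ x, dist (φ i x) o < R i →
      dist (φ i x) o ≤ M → dist (ψ i x) (g (φ i x)) < δ := by
  have := properSpace_of_isAlmostIsometric hε hR h
  obtain ⟨s, hsv, hsR, hs⟩ := exists_approx_section hε hR h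
  have hpR : ∀ᶠ i in U, dist (φ i p) o < R i := by
    filter_upwards [h, hR.eventually_gt_atTop 0] with i hi hRi
    rwa [hi.left_point, dist_self]
  -- The images of `v` stay in a compact ball of `Y`, so they converge along the ultrafilter without
  -- passing to subsequences.
  have hlim : ∀ v, ∃ y, Tendsto (fun i => ψ i (s i v)) U (𝓝 y) := by
    intro v
    have hmem : ∀ᶠ i in U, ψ i (s i v) ∈ Metric.closedBall q (dist v o + 1) := by
      filter_upwards [h, hpR, hs v 1 one_pos] with i hi hp hb
      have h1 := hb p hp
      rw [hi.left_point, hi.right_point, abs_lt, dist_comm q, dist_comm o] at h1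
      rw [Metric.mem_closedBall]
      linarith [h1.2]
    obtain ⟨y, -, hy⟩ := (isCompact_closedBall q (dist v o + 1)).ultrafilter_le_nhds
      (U.map fun i => ψ i (s i v)) (le_principal_iff.2 hmem)
    exact ⟨y, hy⟩
  choose g hg using hlim
  have hgd : ∀ v, ∀ δ > 0, ∀ᶠ i in U, ∀ x, dist (φ i x) o < R i →
      |dist (ψ i x) (g v) - dist (φ i x) v| < δ := by
    intro v δ hδ
    filter_upwards [hs v _ (half_pos hδ), Metric.tendsto_nhds.1 (hg v) _ (half_pos hδ)]
      with i hi hi2 x hx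
    have h1 := hi x hx
    have h2 := abs_dist_sub_le (ψ i (s i v)) (g v) (ψ i x)
    rw [dist_comm (ψ i (s i v)) (ψ i x), dist_comm (g v) (ψ i x)] at h2
    rw [abs_lt] at h1 ⊢
    rw [abs_le] at h2
    constructor <;> linarith [h1.1, h1.2, h2.1, h2.2]
  have hiso : Isometry g := by
    refine Isometry.of_dist_eq fun v w => ?_
    have h1 : Tendsto (fun i => dist (ψ i (s i v)) (g w) - dist (φ i (s i v)) w) U (𝓝 0) := by
      refine Metric.tendsto_nhds.2 fun δ hδ => ?_
      filter_upwards [hgd w δ hδ, hsR v] with i hi hi2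
      rw [Real.dist_eq, sub_zero]
      exact hi _ hi2
    have h2 := ((hg v).dist (tendsto_const_nhds (x := g w))).sub
      ((hsv v).dist (tendsto_const_nhds (x := w)))
    exact sub_eq_zero.1 (tendsto_nhds_unique h2 h1)
  -- A finite net of the ball of radius `M` upgrades the estimate at single points `v` to one
  -- uniform in `x`.
  have hunif : ∀ M δ : ℝ, 0 < δ → ∀ᶠ i in U, ∀ x, dist (φ i x) o < R i →
      dist (φ i x) o ≤ M → dist (ψ i x) (g (φ i x)) < δ := by
    intro M δ hδ
    have hδ3 : 0 < δ / 3 := by positivity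
    obtain ⟨t, htfin, ht⟩ := Metric.totallyBounded_iff.1
      (isCompact_closedBall o M).totallyBounded (δ / 3) hδ3
    filter_upwards [(eventually_all_finite htfin).2 fun v _ => hgd v _ hδ3] with i hi x hx hxM
    obtain ⟨v, hv, hxv⟩ := mem_iUnion₂.1 (ht (Metric.mem_closedBall.2 hxM))
    rw [Metric.mem_ball] at hxv
    have h1 := abs_lt.1 (hi v hv x hx)
    have h2 := dist_triangle (ψ i x) (g v) (g (φ i x))
    rw [hiso.dist_eq, dist_comm v] at h2
    linarith [h1.2]
  have hsurj : Function.Surjective g := by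
    intro y
    -- Almost surjectivity of `ψ i` makes the range dense, and the isometric image of a complete
    -- space is closed.
    have hcl : y ∈ closure (range g) := by
      refine Metric.mem_closure_range_iff.2 fun δ hδ => ?_
      obtain ⟨i, hi, hu, hR1, hε1, hε2⟩ := (h.and ((hunif (dist y q + 1) _ (half_pos hδ)).and
        ((hR.eventually_gt_atTop (dist y q + 1)).and ((hε.eventually_lt_const (half_pos hδ)).and
          (hε.eventually_lt_const one_half_pos))))).exists
      obtain ⟨x, hx, hyx⟩ := hi.right_dense y (by linarith)
      have hRpos : dist (φ i p) o < R i := by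
        rw [hi.left_point, dist_self]
        exact lt_of_le_of_lt dist_nonneg hx
      have h1 := hi.abs_dist_sub_le x p hx hRpos
      rw [hi.left_point, hi.right_point, abs_le] at h1
      have h2 := dist_triangle_left (ψ i x) q y
      have h3 := hu x hx (by linarith [h1.2])
      exact ⟨φ i x, by linarith [dist_triangle y (ψ i x) (g (φ i x))]⟩
    rw [hiso.isClosedEmbedding.isClosed_range.closure_eq] at hcl
    exact hcl
  refine ⟨⟨Equiv.ofBijective g ⟨hiso.injective, hsurj⟩, hiso⟩, ?_, hunif⟩
  refine dist_le_zero.1 (le_of_forall_pos_lt_add fun δ hδ => ?_)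
  obtain ⟨i, hi, hp, hd⟩ := (h.and (hpR.and (hgd o δ hδ))).exists
  have h1 := hd p hp
  rw [hi.left_point, hi.right_point, dist_self, sub_zero, abs_of_nonneg dist_nonneg,
    dist_comm] at h1
  rw [zero_add]
  exact h1

end GromovHausdorff

/-! ### Any tangent agrees with a blow-up model -/

section Uniqueness

/-- A sequence of dilations of `X` onto increasingly dense subsets of `(Z, o)`, along which the
rescaled measures converge to `ν`. -/
structure IsBlowUpModel {X Z : Type*} [MetricSpace X] [MeasurableSpace X] [MetricSpace Z]
    [MeasurableSpace Z] (m : Measure X) (p : X) (r : ℕ → ℝ) (φ : ℕ → X → Z) (o : Z)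
    (ν : Measure Z) : Prop where
  pos : ∀ k, 0 < r k
  dist_eq : ∀ k x y, dist (φ k x) (φ k y) = (r k)⁻¹ * dist x y
  point : ∀ k, φ k p = o
  dense : ∀ R δ : ℝ, 0 < R → 0 < δ → ∀ᶠ k in atTop, ∀ v ∈ Metric.ball o R,
    ∃ x, dist (φ k x) v < δ
  tendsto : ∀ R : ℝ, 0 < R → ∀ f : Z →ᵇ ℝ,
    Tendsto (fun k => ((m (Metric.ball p (r k)))⁻¹).toReal *
      ∫ x in Metric.ball p (R * r k), f (φ k x) ∂m) atTop (𝓝 (∫ y in Metric.ball o R, f y ∂ν))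

variable {X : Type u} {Z : Type v} [MetricSpace X] [MeasurableSpace X] [MetricSpace Z]
  [MeasurableSpace Z] {m : Measure X} {p : X} {r : ℕ → ℝ} {φ : ℕ → X → Z}
  {o : Z} {ν : Measure Z}

theorem IsBlowUpModel.mem_ball_iff (h : IsBlowUpModel m p r φ o ν) (k : ℕ) (R : ℝ) (x : X) :
    x ∈ Metric.ball p (R * r k) ↔ dist (φ k x) o < R := by
  have := h.pos k
  rw [← h.point k, h.dist_eq, inv_mul_lt_iff₀ this, Metric.mem_ball, mul_comm]

theorem IsBlowUpModel.continuous (h : IsBlowUpModel m p r φ o ν) (k : ℕ) : Continuous (φ k) := by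
  have : LipschitzWith (r k)⁻¹.toNNReal (φ k) := by
    refine LipschitzWith.of_dist_le_mul fun x y => ?_
    rw [h.dist_eq, Real.coe_toNNReal _ (inv_nonneg.2 (h.pos k).le)]
  exact this.continuous

/-- Convergence is known only for almost every radius, but `(n + 2, ∞)` is not null, so a good
radius `R > n + 2` exists for the error `1 / (n + 2)`. -/
theorem RescalingsConverge.exists_maps {Y : PointedMMSpace.{w}}
    [BorelSpace X]
    (hY : RescalingsConverge m p r Y) (n : ℕ) :
    ∃ (R : ℝ) (k₀ : ℕ) (ψ : ℕ → X → Y.carrier), (n : ℝ) + 2 < R ∧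
      (∀ k, k₀ ≤ k → Measurable (ψ k) ∧ ψ k p = Y.point ∧
        (∀ x ∈ Metric.ball p (R * r k), ∀ y ∈ Metric.ball p (R * r k),
          |dist x y - r k * dist (ψ k x) (ψ k y)| ≤ 1 / ((n : ℝ) + 2) * r k) ∧
        Metric.ball Y.point (R - 1 / ((n : ℝ) + 2)) ⊆
          Metric.thickening (1 / ((n : ℝ) + 2)) (ψ k '' Metric.ball p (R * r k))) ∧
      ∀ f : Y.carrier →ᵇ ℝ, Bornology.IsBounded (Function.support f) →
        Tendsto (fun k => ∫ y, f y ∂((m (Metric.ball p (r k)))⁻¹ •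
            (m.restrict (Metric.ball p (R * r k))).map (ψ k))) atTop
          (𝓝 (∫ y in Metric.ball Y.point R, f y ∂Y.measure)) := by
  have hn : (0 : ℝ) ≤ n := n.cast_nonneg
  have h := hY (1 / ((n : ℝ) + 2)) (by positivity) (by
    rw [div_lt_one (by positivity)]; linarith)
  rw [ae_restrict_iff' measurableSet_Ioi] at h
  have hne : ∃ᵐ R ∂(volume : Measure ℝ), R ∈ Ioi ((n : ℝ) + 2) := by
    rw [frequently_ae_mem_iff]
    simp
  obtain ⟨R, hR, hR2⟩ := (hne.and_eventually h).exists
  have hR' : (n : ℝ) + 2 < R := hR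
  obtain ⟨k₀, ψ, h1, h2⟩ := hR2 (show (1 : ℝ) < R by linarith)
  exact ⟨R, k₀, ψ, hR', h1, h2⟩

/-- On a fixed bounded region `ψ i` is uniformly close to `g ∘ φ i`, hence so are the values of `f`;
outside it both compositions vanish. The normalised mass of the region stays bounded, so the
integrals have the same limit. -/
theorem integral_eq_of_isAlmostIsometric {X Z Y ι : Type*} [MetricSpace X] [MeasurableSpace X]
    [MetricSpace Z] [MetricSpace Y] {m : Measure X} {U : Ultrafilter ι}
    {c : ι → ℝ} {φ : ι → X → Z} {ψ : ι → X → Y} {o : Z} {q : Y} {R : ι → ℝ} {g : Z ≃ᵢ Y}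
    (hc : ∀ i, 0 ≤ c i) (hg : g o = q)
    (hunif : ∀ M δ : ℝ, 0 < δ → ∀ᶠ i in U, ∀ x, dist (φ i x) o < R i →
      dist (φ i x) o ≤ M → dist (ψ i x) (g (φ i x)) < δ)
    (hdist : ∀ᶠ i in U, ∀ x, dist (φ i x) o < R i → |dist (φ i x) o - dist (ψ i x) q| ≤ 1)
    {f : Y → ℝ} (hf : UniformContinuous f) (hsupp : Bornology.IsBounded (Function.support f))
    (hfin : ∀ i, m {x | dist (φ i x) o < R i} < ⊤)
    (hmeas : ∀ i s, MeasurableSet {x | dist (φ i x) o < s})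
    (hψ : ∀ᶠ i in U, IntegrableOn (fun x => f (ψ i x)) {x | dist (φ i x) o < R i} m)
    (hφ : ∀ i, IntegrableOn (fun x => f (g (φ i x))) {x | dist (φ i x) o < R i} m)
    (hbound : ∀ S : ℝ, ∃ B : ℝ, ∀ᶠ i in U, c i * m.real {x | dist (φ i x) o < S} ≤ B)
    (hR : Tendsto R U atTop) {a b : ℝ}
    (ha : Tendsto (fun i => c i * ∫ x in {x | dist (φ i x) o < R i}, f (ψ i x) ∂m) U (𝓝 a))
    (hb : Tendsto (fun i => c i * ∫ x in {x | dist (φ i x) o < R i}, f (g (φ i x)) ∂m) U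
      (𝓝 b)) : a = b := by
  obtain ⟨M, hM⟩ := hsupp.subset_ball q
  have hzero : ∀ y, M ≤ dist y q → f y = 0 := fun y hy => by
    by_contra hne
    exact absurd (Metric.mem_ball.1 (hM hne)) (not_lt.2 hy)
  obtain ⟨B, hB⟩ := hbound (M + 2)
  have hlim : Tendsto (fun i => c i * ∫ x in {x | dist (φ i x) o < R i}, f (ψ i x) ∂m -
      c i * ∫ x in {x | dist (φ i x) o < R i}, f (g (φ i x)) ∂m) U (𝓝 0) := by
    refine Metric.tendsto_nhds.2 fun η hη => ?_
    have hη' : 0 < η / (|B| + 1) := by positivity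
    obtain ⟨δ, hδ, hfδ⟩ := Metric.uniformContinuous_iff.1 hf _ hη'
    filter_upwards [hunif (M + 2) δ hδ, hdist, hψ, hB, hR.eventually_gt_atTop (M + 2)]
      with i hu hd hψi hBi hRi
    -- The radius `M + 2` leaves room for the distortion `1`: beyond it both `ψ i x` and `g (φ i x)`
    -- are outside the `M`-ball that carries `f`.
    have hpt : ∀ x ∈ {x | dist (φ i x) o < R i}, ‖f (ψ i x) - f (g (φ i x))‖ ≤
        {x | dist (φ i x) o < M + 2}.indicator (fun _ => η / (|B| + 1)) x := by
      intro x hx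
      by_cases hxM : dist (φ i x) o < M + 2
      · rw [indicator_of_mem (show x ∈ {x | dist (φ i x) o < M + 2} from hxM)]
        exact (hfδ (hu x hx hxM.le)).le
      · rw [indicator_of_notMem (show x ∉ {x | dist (φ i x) o < M + 2} from hxM)]
        have h1 := (abs_le.1 (hd x hx)).2
        have h2 : dist (g (φ i x)) q = dist (φ i x) o := by
          rw [← hg, g.isometry.dist_eq]
        rw [hzero _ (by linarith), hzero _ (by rw [h2]; linarith)]
        simp
    have hsub : {x | dist (φ i x) o < M + 2} ⊆ {x | dist (φ i x) o < R i} :=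
      fun x hx => lt_trans hx hRi
    rw [Real.dist_eq, sub_zero, ← mul_sub, ← integral_sub hψi (hφ i), abs_mul,
      abs_of_nonneg (hc i)]
    have hint : |∫ x in {x | dist (φ i x) o < R i}, (f (ψ i x) - f (g (φ i x))) ∂m| ≤
        η / (|B| + 1) * m.real {x | dist (φ i x) o < M + 2} := by
      refine (norm_integral_le_integral_norm _).trans
        ((setIntegral_mono_on (hψi.sub (hφ i)).norm ?_ (hmeas i _) hpt).trans (le_of_eq ?_))
      · refine IntegrableOn.indicator ?_ (hmeas i _)
        exact integrableOn_const (hfin i).ne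
      · rw [setIntegral_indicator (hmeas i _), inter_eq_self_of_subset_right hsub,
          setIntegral_const, smul_eq_mul, mul_comm]
    calc c i * |∫ x in {x | dist (φ i x) o < R i}, (f (ψ i x) - f (g (φ i x))) ∂m|
        ≤ c i * (η / (|B| + 1) * m.real {x | dist (φ i x) o < M + 2}) :=
          mul_le_mul_of_nonneg_left hint (hc i)
      _ = η / (|B| + 1) * (c i * m.real {x | dist (φ i x) o < M + 2}) := by ring
      _ ≤ η / (|B| + 1) * |B| := by
          gcongr
          exact hBi.trans (le_abs_self B)
      _ < η := by
          rw [div_mul_eq_mul_div, div_lt_iff₀ (by positivity)]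
          nlinarith [abs_nonneg B]
  exact sub_eq_zero.1 (tendsto_nhds_unique (ha.sub hb) hlim)

theorem IsBlowUpModel.isAlmostIsometric {Y : Type*} [MetricSpace Y]
    (h : IsBlowUpModel m p r φ o ν) {k : ℕ} {ψ : X → Y} {q : Y} {R ε : ℝ} (hε1 : ε ≤ 1)
    (hψ : ψ p = q)
    (hdist : ∀ x ∈ Metric.ball p (R * r k), ∀ y ∈ Metric.ball p (R * r k),
      |dist x y - r k * dist (ψ x) (ψ y)| ≤ ε * r k)
    (hthick : Metric.ball q (R - ε) ⊆ Metric.thickening ε (ψ '' Metric.ball p (R * r k)))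
    (hdense : ∀ v ∈ Metric.ball o (R - 1), ∃ x, dist (φ k x) v < ε) :
    IsAlmostIsometric o q p (φ k) ψ R ε where
  left_point := h.point k
  right_point := hψ
  abs_dist_sub_le x y hx hy := by
    have hk := h.pos k
    have h1 := hdist x ((h.mem_ball_iff k R x).2 hx) y ((h.mem_ball_iff k R y).2 hy)
    have h2 : dist x y - r k * dist (ψ x) (ψ y) =
        r k * (dist (φ k x) (φ k y) - dist (ψ x) (ψ y)) := by
      rw [h.dist_eq]
      field_simp
    rw [h2, abs_mul, abs_of_pos hk, mul_comm ε] at h1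
    exact le_of_mul_le_mul_left h1 hk
  left_dense v hv := by
    obtain ⟨x, hx⟩ := hdense v hv
    exact ⟨x, by linarith [dist_triangle (φ k x) v o], hx⟩
  right_dense y hy := by
    obtain ⟨z, ⟨x, hx, rfl⟩, hz⟩ := Metric.mem_thickening_iff.1 (hthick hy)
    exact ⟨x, (h.mem_ball_iff k R x).1 hx, hz⟩

theorem setIntegral_ball_eq_integral {Y : Type*} [MetricSpace Y] [MeasurableSpace Y]
    {μ : Measure Y} {f : Y → ℝ} {q : Y} {M S : ℝ} (hM : Function.support f ⊆ Metric.ball q M)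
    (hS : M ≤ S) : ∫ y in Metric.ball q S, f y ∂μ = ∫ y, f y ∂μ :=
  setIntegral_eq_integral_of_forall_compl_eq_zero fun y hy => by
    by_contra hne
    exact hy (Metric.ball_subset_ball hS (hM hne))

/-- Uniqueness of the tangent along a given sequence of scales. -/
theorem IsBlowUpModel.exists_isometryEquiv [BorelSpace X] [BorelSpace Z] [ProperSpace Z]
    (h : IsBlowUpModel m p r φ o ν) (hm : ∀ s, Bornology.IsBounded s → m s < ⊤)
    (hν : ∀ s, Bornology.IsBounded s → ν s < ⊤) {Y : PointedMMSpace.{w}}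
    (hY : RescalingsConverge m p r Y) :
    ∃ g : Z ≃ᵢ Y.carrier, g o = Y.point ∧ ν.map g = Y.measure := by
  choose R k₀ ψ hR hψ hψm using fun n => hY.exists_maps n
  have := Y.isMetricMeasureSpace.complete
  have hne : ((atTop : Filter ℕ).curry (atTop : Filter ℕ)).NeBot := by
    rw [neBot_iff, Ne, ← eventually_false_iff_eq_bot, eventually_curry_iff]
    exact fun h => h.exists.elim fun _ h => h.exists.elim fun _ h => h
  -- An index `(n, k)` pairs an accuracy with a scale. The maps and the threshold for `k` depend on
  -- `n`, so the limit is iterated, `k → ∞` for each fixed `n`; this is what `curry` encodes.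
  set U : Ultrafilter (ℕ × ℕ) := Ultrafilter.of ((atTop : Filter ℕ).curry (atTop : Filter ℕ))
  have hU : (U : Filter (ℕ × ℕ)) ≤ (atTop : Filter ℕ).curry (atTop : Filter ℕ) :=
    Ultrafilter.of_le _
  have hfst : Tendsto Prod.fst (U : Filter (ℕ × ℕ)) (atTop : Filter ℕ) :=
    tendsto_fst.mono_left (hU.trans curry_le_prod)
  have hsnd : Tendsto Prod.snd (U : Filter (ℕ × ℕ)) (atTop : Filter ℕ) :=
    tendsto_snd.mono_left (hU.trans curry_le_prod)
  have hRtop : Tendsto R atTop atTop := by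
    refine tendsto_atTop_mono (fun n => ?_) tendsto_natCast_atTop_atTop
    linarith [hR n]
  have hε0 : Tendsto (fun n : ℕ => 1 / ((n : ℝ) + 2)) atTop (𝓝 0) := by
    refine (tendsto_const_nhds (x := (1 : ℝ))).div_atTop ?_
    exact tendsto_atTop_add_const_right _ _ tendsto_natCast_atTop_atTop
  have hε1 : ∀ n : ℕ, 1 / ((n : ℝ) + 2) ≤ 1 := fun n => by
    have : (0 : ℝ) ≤ n := n.cast_nonneg
    rw [div_le_one (by positivity)]
    linarith
  have hk : ∀ᶠ i : ℕ × ℕ in U, k₀ i.1 ≤ i.2 := by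
    refine hU ?_
    rw [← Filter.Eventually, eventually_curry_iff]
    exact Eventually.of_forall fun n => eventually_ge_atTop (k₀ n)
  have halmost : ∀ᶠ i : ℕ × ℕ in U, IsAlmostIsometric o Y.point p (φ i.2) (ψ i.1 i.2) (R i.1)
      (1 / ((i.1 : ℝ) + 2)) := by
    refine hU ?_
    rw [← Filter.Eventually, eventually_curry_iff]
    refine Eventually.of_forall fun n => ?_
    have hn : (0 : ℝ) ≤ n := n.cast_nonneg
    filter_upwards [eventually_ge_atTop (k₀ n), h.dense (R n - 1) (1 / ((n : ℝ) + 2))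
      (by linarith [hR n]) (by positivity)] with k hk hd
    obtain ⟨-, h1, h2, h3⟩ := hψ n k hk
    exact h.isAlmostIsometric (hε1 n) h1 h2 h3 hd
  obtain ⟨g, hg, hunif⟩ := exists_isometryEquiv_of_isAlmostIsometric (hε0.comp hfst)
    (hRtop.comp hfst) halmost
  refine ⟨g, hg, ?_⟩
  have hYproper := properSpace_of_isAlmostIsometric (hε0.comp hfst) (hRtop.comp hfst) halmost
  have hfinY : ∀ x : Y.carrier, Y.measure.FiniteAtFilter (𝓝 x) := fun x =>
    ⟨_, Metric.ball_mem_nhds x one_pos,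
      Y.isMetricMeasureSpace.boundedlyFinite _ Metric.isBounded_ball⟩
  have hgm : MeasurableEmbedding g := g.toHomeomorph.measurableEmbedding
  have hfinν : ∀ x : Y.carrier, (ν.map g).FiniteAtFilter (𝓝 x) := fun x => by
    refine ⟨_, Metric.ball_mem_nhds x one_pos, ?_⟩
    rw [hgm.map_apply]
    exact hν _ (g.isometry.antilipschitz.isBounded_preimage Metric.isBounded_ball)
  have : IsLocallyFiniteMeasure Y.measure := ⟨hfinY⟩
  have : IsLocallyFiniteMeasure (ν.map g) := ⟨hfinν⟩
  -- Both measures are locally finite on the proper space `Y`, so compactly supported continuous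
  -- functions separate them.
  refine Measure.ext_of_integral_eq_on_compactlySupported fun f => ?_
  have hfu : UniformContinuous f := f.hasCompactSupport.uniformContinuous_of_continuous f.continuous
  have hsupp : Bornology.IsBounded (Function.support f) :=
    f.hasCompactSupport.isCompact.isBounded.subset (subset_tsupport _)
  obtain ⟨B, hB⟩ := f.hasCompactSupport.exists_bound_of_continuous f.continuous
  set F : Y.carrier →ᵇ ℝ := BoundedContinuousFunction.ofNormedAddCommGroup f f.continuous B hB
  obtain ⟨M, hM⟩ := hsupp.subset_ball Y.point
  have hset : ∀ (k : ℕ) (S : ℝ), {x | dist (φ k x) o < S} = Metric.ball p (S * r k) :=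
    fun k S => ext fun x => (h.mem_ball_iff k S x).symm
  have hMtop : ∀ᶠ n in atTop, M ≤ R n := hRtop.eventually_ge_atTop M
  rw [hgm.integral_map]
  symm
  have hgc : ∀ k, Continuous fun x => f (g (φ k x)) := fun k =>
    f.continuous.comp (g.continuous.comp (h.continuous k))
  refine integral_eq_of_isAlmostIsometric (m := m) (U := U) (f := f)
    (c := fun i => ((m (Metric.ball p (r i.2)))⁻¹).toReal) (φ := fun i => φ i.2)
    (ψ := fun i => ψ i.1 i.2) (R := fun i => R i.1) (fun i => ENNReal.toReal_nonneg) hg hunif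
    ?_ hfu hsupp ?_ ?_ ?_ ?_ ?_ (hRtop.comp hfst) ?_ ?_
  · filter_upwards [halmost] with i hi x hx
    have hp : dist (φ i.2 p) o < R i.1 := by
      rw [hi.left_point, dist_self]
      exact lt_of_le_of_lt dist_nonneg hx
    have h1 := hi.abs_dist_sub_le x p hx hp
    rw [hi.left_point, hi.right_point] at h1
    exact h1.trans (hε1 i.1)
  · intro i
    rw [hset]
    exact hm _ Metric.isBounded_ball
  · intro i S
    rw [hset]
    exact Metric.isOpen_ball.measurableSet
  · filter_upwards [hk] with i hi
    rw [hset]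
    exact Measure.integrableOn_of_bounded (hm _ Metric.isBounded_ball).ne
      (f.continuous.measurable.comp (hψ i.1 i.2 hi).1).aestronglyMeasurable
      (ae_of_all _ fun x => hB _)
  · intro i
    rw [hset]
    exact Measure.integrableOn_of_bounded (hm _ Metric.isBounded_ball).ne
      (hgc i.2).measurable.aestronglyMeasurable (ae_of_all _ fun x => hB _)
  · intro S
    rcases le_or_gt S 0 with hS | hS
    · refine ⟨0, Eventually.of_forall fun i => ?_⟩
      rw [hset, Metric.ball_eq_empty.2 (mul_nonpos_of_nonpos_of_nonneg hS (h.pos i.2).le)]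
      simp
    -- The constant test function bounds the normalised mass of balls.
    · have h1 := h.tendsto S hS (BoundedContinuousFunction.const Z 1)
      simp only [BoundedContinuousFunction.const_apply, setIntegral_const, smul_eq_mul,
        mul_one] at h1
      refine ⟨ν.real (Metric.ball o S) + 1, ?_⟩
      filter_upwards [hsnd.eventually (h1.eventually_lt_const (lt_add_one _))] with i hi
      rw [hset]
      exact hi.le
  · refine Metric.tendsto_nhds.2 fun δ hδ => hU ?_
    rw [← Filter.Eventually, eventually_curry_iff]
    -- Once `R n ≥ M`, the ball contains the support of `f`, so the limit in `k` is the full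
    -- integral and no longer depends on `n`.
    filter_upwards [hMtop] with n hn
    have h1 := hψm n F hsupp
    rw [show ∫ y in Metric.ball Y.point (R n), F y ∂Y.measure = ∫ y, f y ∂Y.measure from
      setIntegral_ball_eq_integral hM hn] at h1
    filter_upwards [Metric.tendsto_nhds.1 h1 δ hδ, eventually_ge_atTop (k₀ n)] with k hk1 hk2
    rw [hset]
    rwa [integral_rescaled _ _ _ (hψ n k hk2).1] at hk1
  · refine Metric.tendsto_nhds.2 fun δ hδ => hU ?_
    rw [← Filter.Eventually, eventually_curry_iff]
    filter_upwards [hMtop] with n hn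
    have h1 := h.tendsto (R n) (by have := hR n; have : (0 : ℝ) ≤ n := n.cast_nonneg; linarith)
      (F.compContinuous ⟨g, g.continuous⟩)
    have hMg : Function.support (fun z => f (g z)) ⊆ Metric.ball o M := fun z hz => by
      have h2 : g z ∈ Metric.ball Y.point M := hM hz
      rwa [← hg, Metric.mem_ball, g.isometry.dist_eq] at h2
    rw [show ∫ y in Metric.ball o (R n), F.compContinuous ⟨g, g.continuous⟩ y ∂ν =
      ∫ z, f (g z) ∂ν from setIntegral_ball_eq_integral (f := fun z => f (g z)) hMg hn] at h1
    filter_upwards [Metric.tendsto_nhds.1 h1 δ hδ] with k hk1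
    rw [hset]
    exact hk1

end Uniqueness

/-! ### Tangents of the square at density points -/

section TangentUniqueness

variable {C : Set ℝ} {p : Square C}

theorem isBlowUpModel_blowUp (hC : IsCompact C)
    (h : IsDensityPoint {p : L1Plane | p.fst ∈ C ∧ p.snd ∈ C} p.1)
    {r : ℕ → ℝ} (hr : ∀ k, 0 < r k) (hr0 : Tendsto r atTop (𝓝 0)) :
    IsBlowUpModel (squareMeasure C) p r (fun k => blowUp p (r k)) 0 normalisedLebesgue where
  pos := hr
  dist_eq k x y := dist_blowUp (hr k) x y
  point _ := blowUp_self _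
  dense _ _ hR hδ := eventually_exists_dist_blowUp_lt h hr hr0 hR hδ
  tendsto _ hR f := tendsto_setIntegral_blowUp hC h hr hr0 hR f.continuous.measurable
    f.norm_coe_le_norm

theorem isIsomorphic_of_mem_tangentCone (hC : IsCompact C)
    (h : IsDensityPoint {p : L1Plane | p.fst ∈ C ∧ p.snd ∈ C} p.1) {Y : PointedMMSpace.{u}}
    (hY : Y ∈ tangentCone (squareMeasure C) p) : Y.IsIsomorphic pointedL1Plane := by
  obtain ⟨-, r, hr, -, hr0, hconv⟩ := hY
  obtain ⟨g, hg, hgν⟩ := (isBlowUpModel_blowUp hC h hr hr0).exists_isometryEquiv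
    (isMetricMeasureSpace_square hC).boundedlyFinite
    pointedL1Plane.isMetricMeasureSpace.boundedlyFinite hconv
  have hmeas : Measurable g := g.continuous.measurable
  have hmeas' : Measurable g.symm := g.symm.continuous.measurable
  have hpt : g.symm Y.point = 0 := by rw [← hg, g.symm_apply_apply]
  have hmap : Y.measure.map g.symm = normalisedLebesgue := by
    rw [← hgν, Measure.map_map hmeas' hmeas, show g.symm ∘ g = id from g.symm_comp_self,
      Measure.map_id]
  exact ⟨g.symm, hpt, hmap⟩

end TangentUniqueness

/-! ### Lower bounds for the relaxed energy -/

section SlopeBounds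

theorem slope_le_of_eventually {X : Type u} [MetricSpace X] {f : X → ℝ} {x : X} {K : ℝ}
    (h : ∀ᶠ y in 𝓝 x, |f y - f x| ≤ K * dist y x) : slope f x ≤ ENNReal.ofReal K := by
  refine limsup_le_of_le (by isBoundedDefault) ?_
  filter_upwards [nhdsWithin_le_nhds h, self_mem_nhdsWithin] with y hy hne
  exact ENNReal.ofReal_le_ofReal ((div_le_iff₀ (dist_pos.2 hne)).2 hy)

variable {E : Type u} [NormedAddCommGroup E] [NormedSpace ℝ E]

/-- Difference quotients along a unit-speed line are among those entering the slope, and a limsup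
along a finer filter is smaller. At points of non-differentiability `deriv` is `0`. -/
theorem enorm_deriv_le_slope (w : E → ℝ) (x : E) {e : E} (he : ‖e‖ = 1) (s : ℝ) :
    ‖deriv (fun s : ℝ => w (x + s • e)) s‖ₑ ≤ slope w (x + s • e) := by
  by_cases hd : DifferentiableAt ℝ (fun s : ℝ => w (x + s • e)) s
  swap
  · rw [deriv_zero_of_not_differentiableAt hd]
    simp
  have h1 := hasDerivAt_iff_tendsto_slope.1 hd.hasDerivAt
  have hdist : ∀ s' : ℝ, dist (x + s' • e) (x + s • e) = |s' - s| := fun s' => by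
    rw [dist_add_left, dist_eq_norm, ← sub_smul, norm_smul, he, mul_one, Real.norm_eq_abs]
  have h2 : Tendsto (fun s' : ℝ => ENNReal.ofReal (|w (x + s' • e) - w (x + s • e)| /
      dist (x + s' • e) (x + s • e))) (𝓝[≠] s)
      (𝓝 ‖deriv (fun s : ℝ => w (x + s • e)) s‖ₑ) := by
    have h3 := (ENNReal.continuous_ofReal.tendsto _).comp h1.norm
    rw [ofReal_norm] at h3
    refine h3.congr fun s' => ?_
    simp only [Function.comp_apply]
    rw [slope_def_field, hdist, norm_div, Real.norm_eq_abs, Real.norm_eq_abs]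
  have h4 : Tendsto (fun s' : ℝ => x + s' • e) (𝓝[≠] s) (𝓝[≠] (x + s • e)) := by
    refine tendsto_nhdsWithin_of_tendsto_nhds_of_eventually_within _
      (Continuous.tendsto' (by fun_prop) _ _ rfl |>.mono_left nhdsWithin_le_nhds) ?_
    filter_upwards [self_mem_nhdsWithin] with s' hs' heq
    have := hdist s'
    rw [heq, dist_self] at this
    exact hs' (sub_eq_zero.1 (abs_eq_zero.1 this.symm))
  rw [← h2.limsup_eq]
  exact limsup_le_limsup_of_le
    (u := fun y => ENNReal.ofReal (|w y - w (x + s • e)| / dist y (x + s • e))) h4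

theorem sq_lintegral_le {α : Type*} [MeasurableSpace α] (μ : Measure α) {f : α → ℝ≥0∞}
    (hf : AEMeasurable f μ) : (∫⁻ a, f a ∂μ) ^ 2 ≤ μ univ * ∫⁻ a, f a ^ 2 ∂μ := by
  have h := ENNReal.lintegral_mul_le_Lp_mul_Lq μ Real.HolderConjugate.two_two hf
    (aemeasurable_const (b := (1 : ℝ≥0∞)))
  simp only [Pi.mul_apply, mul_one, lintegral_const, one_pow, one_mul, ENNReal.rpow_two] at h
  calc (∫⁻ a, f a ∂μ) ^ 2
      ≤ ((∫⁻ a, f a ^ 2 ∂μ) ^ (1 / 2 : ℝ) * μ univ ^ (1 / 2 : ℝ)) ^ 2 := by gcongr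
    _ = μ univ * ∫⁻ a, f a ^ 2 ∂μ := by
        rw [mul_pow, ← ENNReal.rpow_mul_natCast, ← ENNReal.rpow_mul_natCast]
        norm_num [mul_comm]

variable [MeasurableSpace E] [BorelSpace E]

/-- A Lipschitz function is absolutely continuous on lines, so the increment is the integral of the
derivative; then Cauchy-Schwarz on `(0, t]`. -/
theorem enorm_sub_sq_le_lintegral_slope {w : E → ℝ} {K : ℝ≥0} (hw : LipschitzWith K w) (x : E)
    {e : E} (he : ‖e‖ = 1) {t : ℝ} (ht : 0 ≤ t) :
    ‖w (x + t • e) - w x‖ₑ ^ 2 ≤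
      ENNReal.ofReal t * ∫⁻ s in Ioc 0 t, slope w (x + s • e) ^ 2 := by
  set γ : ℝ → ℝ := fun s => w (x + s • e)
  have hγ : LipschitzWith K γ := by
    refine LipschitzWith.of_dist_le_mul fun s s' => (hw.dist_le_mul _ _).trans (le_of_eq ?_)
    rw [dist_add_left, dist_eq_norm, ← sub_smul, norm_smul, he, mul_one, Real.dist_eq,
      Real.norm_eq_abs]
  have hint :=
    (hγ.lipschitzOnWith (s := uIcc 0 t)).absolutelyContinuousOnInterval.integral_deriv_eq_sub
  have hmeas : Measurable fun s : ℝ => slope w (x + s • e) :=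
    (measurable_slope hw.continuous).comp (by fun_prop)
  have h1 : ‖w (x + t • e) - w x‖ₑ ≤ ∫⁻ s in Ioc 0 t, slope w (x + s • e) := by
    have : w (x + t • e) - w x = ∫ s in Ioc 0 t, deriv γ s := by
      rw [← intervalIntegral.integral_of_le ht, hint]
      simp [γ]
    rw [this]
    exact (enorm_integral_le_lintegral_enorm _).trans
      (lintegral_mono fun s => enorm_deriv_le_slope w x he s)
  calc ‖w (x + t • e) - w x‖ₑ ^ 2 ≤ (∫⁻ s in Ioc 0 t, slope w (x + s • e)) ^ 2 := by gcongr
    _ ≤ _ := sq_lintegral_le _ hmeas.aemeasurable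
    _ = _ := by rw [Measure.restrict_apply_univ, Real.volume_Ioc, sub_zero]

variable (m : Measure E) [m.IsAddLeftInvariant] [SFinite m] [SecondCountableTopology E]

/-- Difference quotients are controlled by the slope energy. -/
theorem lintegral_enorm_sub_sq_le {w : E → ℝ} {K : ℝ≥0} (hw : LipschitzWith K w)
    {e : E} (he : ‖e‖ = 1) {t : ℝ} (ht : 0 ≤ t) :
    ∫⁻ x, ‖w (x + t • e) - w x‖ₑ ^ 2 ∂m ≤ ENNReal.ofReal t ^ 2 * slopeEnergy m w := by
  have hmeas := (measurable_slope hw.continuous).pow_const 2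
  calc ∫⁻ x, ‖w (x + t • e) - w x‖ₑ ^ 2 ∂m
      ≤ ∫⁻ x, (ENNReal.ofReal t * ∫⁻ s in Ioc 0 t, slope w (x + s • e) ^ 2) ∂m :=
        lintegral_mono fun x => enorm_sub_sq_le_lintegral_slope hw x he ht
    _ = ENNReal.ofReal t * ∫⁻ x, (∫⁻ s in Ioc 0 t, slope w (x + s • e) ^ 2) ∂m :=
        lintegral_const_mul' _ _ ENNReal.ofReal_ne_top
    _ = ENNReal.ofReal t * ∫⁻ s in Ioc 0 t, ∫⁻ x, slope w (x + s • e) ^ 2 ∂m := by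
        rw [lintegral_lintegral_swap]
        exact (hmeas.comp (by fun_prop : Measurable fun z : E × ℝ => z.1 + z.2 • e)).aemeasurable
    _ = ENNReal.ofReal t * ∫⁻ _ in Ioc 0 t, slopeEnergy m w := by
        congr 1
        refine lintegral_congr fun s => ?_
        -- After exchanging the integrals, translation invariance makes the inner one independent of
        -- `s`.
        exact lintegral_add_right_eq_self (fun x => slope w x ^ 2) (s • e)
    _ = _ := by
        rw [lintegral_const, Measure.restrict_apply_univ, Real.volume_Ioc, sub_zero]
        ring

theorem eLpNorm_two_sq {α : Type*} [MeasurableSpace α] (μ : Measure α) (f : α → ℝ) :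
    eLpNorm f 2 μ ^ 2 = ∫⁻ x, ‖f x‖ₑ ^ 2 ∂μ := by
  rw [eLpNorm_eq_lintegral_rpow_enorm_toReal (by norm_num) (by norm_num),
    ← ENNReal.rpow_mul_natCast]
  simp

/-- Difference quotients are controlled by the relaxed energy. -/
theorem lintegral_enorm_sub_sq_le_relaxedEnergy (f : Lp ℝ 2 m) {u : E → ℝ} (hu : f =ᵐ[m] u)
    (hcont : Continuous u) {e : E} (he : ‖e‖ = 1) {t : ℝ} (ht : 0 < t) :
    ∫⁻ x, ‖u (x + t • e) - u x‖ₑ ^ 2 ∂m ≤ ENNReal.ofReal t ^ 2 * relaxedEnergy m f := by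
  unfold relaxedEnergy
  have ht0 : ENNReal.ofReal t ^ 2 ≠ 0 := by simpa using ht
  have htt : ENNReal.ofReal t ^ 2 ≠ ⊤ := by finiteness
  rw [mul_comm, ← ENNReal.div_le_iff_le_mul (Or.inl ht0) (Or.inl htt)]
  refine le_iInf₂ fun w hw => ?_
  rw [ENNReal.div_le_iff_le_mul (Or.inl ht0) (Or.inl htt), mul_comm]
  have hwc : ∀ n, Continuous (w n) := fun n => (hw.1 n).1.choose_spec.continuous
  have htrans : ∀ g : E → ℝ, Continuous g → eLpNorm (fun x => g (x + t • e)) 2 m = eLpNorm g 2 m :=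
    fun g hg => eLpNorm_comp_measurePreserving hg.aestronglyMeasurable
      (measurePreserving_add_right m (t • e))
  set η : ℕ → ℝ≥0∞ := fun n => eLpNorm (fun x => w n x - u x) 2 m
  have hη : Tendsto η atTop (𝓝 0) := by
    refine hw.2.congr fun n => eLpNorm_congr_ae ?_
    filter_upwards [hu] with x hx
    rw [hx]
  -- Replacing `u` by `w n` costs the `L²` error twice, once at `x` and once at the translated
  -- point.
  have hkey : ∀ n, eLpNorm (fun x => u (x + t • e) - u x) 2 m ≤
      ENNReal.ofReal t * slopeEnergy m (w n) ^ (1 / 2 : ℝ) + 2 * η n := by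
    intro n
    obtain ⟨K, hK⟩ := (hw.1 n).1
    have h1 : eLpNorm (fun x => w n (x + t • e) - w n x) 2 m ≤
        ENNReal.ofReal t * slopeEnergy m (w n) ^ (1 / 2 : ℝ) := by
      refine (ENNReal.pow_le_pow_left_iff two_ne_zero).1 ?_
      rw [eLpNorm_two_sq, mul_pow, ← ENNReal.rpow_mul_natCast]
      norm_num
      exact lintegral_enorm_sub_sq_le m hK he ht.le
    have h2 : (fun x => u (x + t • e) - u x) = (fun x => w n (x + t • e) - w n x) +
        ((fun x => w n x - u x) - fun x => w n (x + t • e) - u (x + t • e)) := by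
      ext x
      simp only [Pi.add_apply, Pi.sub_apply]
      ring
    have hc1 : Continuous fun x => w n (x + t • e) - u (x + t • e) :=
      ((hwc n).sub hcont).comp (by fun_prop : Continuous fun x : E => x + t • e)
    have hc2 : Continuous fun x => w n (x + t • e) - w n x :=
      ((hwc n).comp (by fun_prop : Continuous fun x : E => x + t • e)).sub (hwc n)
    rw [h2]
    refine (eLpNorm_add_le hc2.aestronglyMeasurable
      (((hwc n).sub hcont).aestronglyMeasurable.sub hc1.aestronglyMeasurable)
      (by norm_num)).trans (add_le_add h1 ?_)
    refine (eLpNorm_sub_le ((hwc n).sub hcont).aestronglyMeasurable hc1.aestronglyMeasurable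
      (by norm_num)).trans (le_of_eq ?_)
    rw [htrans (fun x => w n x - u x) ((hwc n).sub hcont), two_mul]
    rfl
  rw [← eLpNorm_two_sq]
  by_contra! hlt
  rw [mul_comm, ← ENNReal.lt_div_iff_mul_lt (Or.inl ht0) (Or.inl htt)] at hlt
  obtain ⟨c, hc1, hc2⟩ := exists_between hlt
  -- A liminf below `c` gives energies below `c` only for infinitely many `n`; that is enough, since
  -- the error term tends to `0`.
  have hfreq := frequently_lt_of_liminf_lt (by isBoundedDefault) hc1
  have hle : eLpNorm (fun x => u (x + t • e) - u x) 2 m ≤ ENNReal.ofReal t * c ^ (1 / 2 : ℝ) := by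
    have hlim : Tendsto (fun n => ENNReal.ofReal t * c ^ (1 / 2 : ℝ) + 2 * η n) atTop
        (𝓝 (ENNReal.ofReal t * c ^ (1 / 2 : ℝ) + 2 * 0)) :=
      tendsto_const_nhds.add (ENNReal.Tendsto.const_mul hη (Or.inr (by simp)))
    rw [mul_zero, add_zero] at hlim
    refine ge_of_tendsto_of_frequently hlim (hfreq.mono fun n hn => (hkey n).trans ?_)
    gcongr
  rw [ENNReal.lt_div_iff_mul_lt (Or.inl ht0) (Or.inl htt)] at hc2
  have h3 := pow_le_pow_left' hle 2
  rw [mul_pow, ← ENNReal.rpow_mul_natCast] at h3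
  norm_num at h3
  exact absurd hc2 (not_lt.2 (h3.trans_eq (mul_comm _ _)))

end SlopeBounds

/-! ### Sawtooth functions and their energies -/

section Corrugation

/-- The distance to the nearest integer. -/
noncomputable def sawtooth (t : ℝ) : ℝ := |t - round t|

theorem sawtooth_nonneg (t : ℝ) : 0 ≤ sawtooth t := abs_nonneg _

theorem sawtooth_le_half (t : ℝ) : sawtooth t ≤ 1 / 2 := abs_sub_round t

theorem abs_sawtooth_sub_le (s t : ℝ) : |sawtooth s - sawtooth t| ≤ |s - t| := by
  have key : ∀ s t : ℝ, sawtooth s ≤ sawtooth t + |s - t| := fun s t => by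
    calc sawtooth s ≤ |s - round t| := round_le s _
      _ = |(s - t) + (t - round t)| := by congr 1; ring
      _ ≤ |s - t| + |t - round t| := abs_add_le _ _
      _ = _ := add_comm _ _
  rw [abs_le]
  constructor
  · have := key t s
    rw [abs_sub_comm t s] at this
    linarith
  · linarith [key s t]

/-- Any other integer is at distance at least `1` from `j`, hence at least `1/2` from `t`; ties at
half-integers do no harm. -/
theorem sawtooth_eq {t : ℝ} {j : ℤ} (h : |t - j| ≤ 1 / 2) : sawtooth t = |t - j| := by
  refine le_antisymm (round_le t j) ?_
  by_cases hj : round t = j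
  · rw [sawtooth, hj]
  · have h1 : (1 : ℝ) ≤ |(round t : ℝ) - j| := by
      exact_mod_cast Int.one_le_abs (sub_ne_zero.2 hj)
    have h2 : |(round t : ℝ) - j| ≤ |t - round t| + |t - j| := by
      rw [abs_sub_comm t (round t)]
      calc |(round t : ℝ) - j| = |((round t : ℝ) - t) + (t - j)| := by congr 1; ring
        _ ≤ _ := abs_add_le _ _
    unfold sawtooth
    linarith

/-- Corners occur only at half-integer multiples `k / 2`. Here `x` and `x + 1/8` lie between two
consecutive ones, where the slope is `1` for even `k` and `-1` for odd `k`. -/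
theorem abs_sawtooth_add_sub {k : ℤ} {x : ℝ} (h1 : (k : ℝ) / 2 < x) (h2 : x < k / 2 + 3 / 8) :
    |sawtooth (x + 1 / 8) - sawtooth x| = 1 / 8 := by
  obtain ⟨j, hj | hj⟩ := Int.even_or_odd' k
  · have hk : (k : ℝ) = 2 * j := by exact_mod_cast hj
    have e1 : |x - j| = x - j := abs_of_nonneg (by linarith)
    have e2 : |x + 1 / 8 - j| = x + 1 / 8 - j := abs_of_nonneg (by linarith)
    rw [sawtooth_eq (t := x) (j := j) (by rw [e1]; linarith),
      sawtooth_eq (t := x + 1 / 8) (j := j) (by rw [e2]; linarith), e1, e2,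
      show x + 1 / 8 - j - (x - j) = 1 / 8 by ring]
    norm_num
  · have hk : (k : ℝ) = 2 * j + 1 := by exact_mod_cast hj
    have hj1 : ((j + 1 : ℤ) : ℝ) = j + 1 := by push_cast; ring
    have e1 : |x - ((j + 1 : ℤ) : ℝ)| = j + 1 - x := by
      rw [hj1, abs_of_nonpos (by linarith)]; ring
    have e2 : |x + 1 / 8 - ((j + 1 : ℤ) : ℝ)| = j + 1 - (x + 1 / 8) := by
      rw [hj1, abs_of_nonpos (by linarith)]; ring
    rw [sawtooth_eq (t := x) (j := j + 1) (by rw [e1]; linarith),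
      sawtooth_eq (t := x + 1 / 8) (j := j + 1) (by rw [e2]; linarith), e1, e2,
      show (j : ℝ) + 1 - (x + 1 / 8) - (j + 1 - x) = -(1 / 8) by ring]
    norm_num

/-- The points of `(-20, 20)` where the sawtooth has no corner on the right within `1 / 8`. -/
def smoothPart : Set ℝ := ⋃ k ∈ Finset.Ico (-40 : ℤ) 40, Ioo ((k : ℝ) / 2) (k / 2 + 3 / 8)

theorem measurableSet_smoothPart : MeasurableSet smoothPart :=
  Finset.measurableSet_biUnion _ fun _ _ => measurableSet_Ioo

theorem smoothPart_subset : smoothPart ⊆ Ioo (-20) 20 := by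
  refine iUnion₂_subset fun k hk x hx => ?_
  rw [Finset.mem_Ico] at hk
  have h1 : (-40 : ℝ) ≤ k := by exact_mod_cast hk.1
  have h2 : (k : ℝ) + 1 ≤ 40 := by exact_mod_cast hk.2
  constructor <;> linarith [hx.1, hx.2]

theorem volume_smoothPart : volume smoothPart = ENNReal.ofReal 30 := by
  have hdisj : (↑(Finset.Ico (-40 : ℤ) 40) : Set ℤ).PairwiseDisjoint
      fun k : ℤ => Ioo ((k : ℝ) / 2) (k / 2 + 3 / 8) := by
    intro k _ l _ hkl
    refine disjoint_left.2 fun x hx hy => hkl ?_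
    have h1 : (k : ℝ) < l + 1 := by linarith [hx.1, hy.2]
    have h2 : (l : ℝ) < k + 1 := by linarith [hx.2, hy.1]
    have h3 : k < l + 1 := by exact_mod_cast h1
    have h4 : l < k + 1 := by exact_mod_cast h2
    omega
  rw [smoothPart, measure_biUnion_finset hdisj fun _ _ => measurableSet_Ioo]
  simp only [Real.volume_Ioo, add_sub_cancel_left, Finset.sum_const, Int.card_Ico]
  rw [nsmul_eq_mul, show ((40 - -40 : ℤ).toNat : ℝ≥0∞) = ENNReal.ofReal 80 by
      rw [show (40 - -40 : ℤ).toNat = 80 from rfl]; norm_num,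
    ← ENNReal.ofReal_mul (by norm_num)]
  norm_num

theorem abs_sub_of_mem_smoothPart {x : ℝ} (hx : x ∈ smoothPart) :
    |sawtooth (x + 1 / 8) - sawtooth x| = 1 / 8 := by
  obtain ⟨k, -, hk⟩ := mem_iUnion₂.1 hx
  exact abs_sawtooth_add_sub hk.1 hk.2

/-- A cutoff function of slope `1`. -/
noncomputable def cutoff (x : L1Plane) : ℝ := max 0 (21 - max |x.fst| |x.snd|)

theorem abs_fst_sub_le (x y : L1Plane) : |x.fst - y.fst| ≤ dist x y := by
  rw [L1Plane.dist_def]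
  exact le_add_of_nonneg_right (abs_nonneg _)

theorem abs_snd_sub_le (x y : L1Plane) : |x.snd - y.snd| ≤ dist x y := by
  rw [L1Plane.dist_def]
  exact le_add_of_nonneg_left (abs_nonneg _)

theorem abs_cutoff_sub_le (x y : L1Plane) : |cutoff x - cutoff y| ≤ dist x y := by
  refine (abs_max_sub_max_le_max _ _ _ _).trans (max_le (by simp) ?_)
  rw [sub_sub_sub_cancel_left, abs_sub_comm]
  refine (abs_max_sub_max_le_max _ _ _ _).trans (max_le ?_ ?_)
  · exact (abs_abs_sub_abs_le_abs_sub _ _).trans (abs_fst_sub_le x y)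
  · exact (abs_abs_sub_abs_le_abs_sub _ _).trans (abs_snd_sub_le x y)

/-- The corrugation of the plane along the coordinate `l`. -/
noncomputable def corrugation (l : L1Plane → ℝ) (x : L1Plane) : ℝ := min (sawtooth (l x)) (cutoff x)

variable {l : L1Plane → ℝ}

theorem lipschitzWith_corrugation (hl : ∀ x y, |l x - l y| ≤ dist x y) :
    LipschitzWith 1 (corrugation l) := by
  refine LipschitzWith.of_dist_le_mul fun x y => ?_
  rw [NNReal.coe_one, one_mul, Real.dist_eq]
  exact (abs_min_sub_min_le_max _ _ _ _).trans
    (max_le ((abs_sawtooth_sub_le _ _).trans (hl x y)) (abs_cutoff_sub_le x y))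

/-- The closed square that supports the corrugations. -/
def box : Set L1Plane := {p | p.fst ∈ Icc (-21) 21 ∧ p.snd ∈ Icc (-21) 21}

/-- The open square where the corrugations are not cut off. -/
def core : Set L1Plane := {p | p.fst ∈ Ioo (-20) 20 ∧ p.snd ∈ Ioo (-20) 20}

theorem continuous_fst_l1 : Continuous fun p : L1Plane => p.fst := WithLp.continuous_fst 1 ℝ ℝ

theorem continuous_snd_l1 : Continuous fun p : L1Plane => p.snd := WithLp.continuous_snd 1 ℝ ℝ

theorem isClosed_box : IsClosed box :=
  (isClosed_Icc.preimage continuous_fst_l1).inter (isClosed_Icc.preimage continuous_snd_l1)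

theorem isOpen_core : IsOpen core :=
  (isOpen_Ioo.preimage continuous_fst_l1).inter (isOpen_Ioo.preimage continuous_snd_l1)

theorem core_subset_box : core ⊆ box := fun _ hp =>
  ⟨⟨by linarith [hp.1.1], by linarith [hp.1.2]⟩, ⟨by linarith [hp.2.1], by linarith [hp.2.2]⟩⟩

theorem isBounded_box : Bornology.IsBounded box := by
  refine Metric.isBounded_closedBall (x := (0 : L1Plane)) (r := 42) |>.subset fun p hp => ?_
  rw [mem_closedBall_zero_iff, L1Plane.norm_def]
  linarith [abs_le.2 hp.1, abs_le.2 hp.2]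

theorem lebesgue_core : lebesgue core = ENNReal.ofReal 1600 := by
  rw [core, lebesgue_prod, Real.volume_Ioo, ← ENNReal.ofReal_mul (by norm_num)]
  norm_num

theorem lebesgue_box : lebesgue box = ENNReal.ofReal 1764 := by
  rw [box, lebesgue_prod, Real.volume_Icc, ← ENNReal.ofReal_mul (by norm_num)]
  norm_num

theorem lebesgue_box_diff_core : lebesgue (box \ core) = ENNReal.ofReal 164 := by
  rw [measure_sdiff core_subset_box isOpen_core.measurableSet.nullMeasurableSet
    (lebesgue_lt_top (isBounded_box.subset core_subset_box)).ne, lebesgue_core, lebesgue_box,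
    ← ENNReal.ofReal_sub _ (by norm_num)]
  norm_num

theorem corrugation_eq_zero {x : L1Plane} (hx : x ∉ box) : corrugation l x = 0 := by
  have h : cutoff x = 0 := by
    refine max_eq_left (sub_nonpos.2 ?_)
    by_contra! hlt
    exact hx ⟨abs_le.1 ((le_max_left _ _).trans hlt.le), abs_le.1 ((le_max_right _ _).trans hlt.le)⟩
  rw [corrugation, h]
  exact min_eq_right (sawtooth_nonneg _)

/-- Here the cutoff is still at least `1/2`, the maximum of the sawtooth. The margin beyond `20`
accommodates translation of the core by `1/8`. -/
theorem corrugation_eq_sawtooth {x : L1Plane} (h1 : |x.fst| ≤ 20 + 1 / 2)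
    (h2 : |x.snd| ≤ 20 + 1 / 2) : corrugation l x = sawtooth (l x) := by
  refine min_eq_left ((sawtooth_le_half _).trans (le_max_of_le_right ?_))
  linarith [max_le h1 h2]

theorem support_corrugation_subset : Function.support (corrugation l) ⊆ box := fun x hx => by
  by_contra h
  exact hx (corrugation_eq_zero h)

/-- A function of slope at most `1` on the core, of Lipschitz constant `2` and supported in the box
has slope energy at most `2256`. -/
theorem slopeEnergy_le_of_core {f : L1Plane → ℝ} (hf : LipschitzWith 2 f)
    (hsupp : Function.support f ⊆ box)
    (hcore : ∀ x ∈ core, ∀ y ∈ core, |f y - f x| ≤ dist y x) :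
    slopeEnergy lebesgue f ≤ ENNReal.ofReal 2256 := by
  -- The slope is at most `1` on the open core, `2` on the rest of the box and `0` outside it, which
  -- gives `1600 + 4 · 164 = 2256`.
  have hpt : ∀ x, slope f x ^ 2 ≤ core.indicator (fun _ => (1 : ℝ≥0∞)) x +
      (box \ core).indicator (fun _ => (4 : ℝ≥0∞)) x := by
    intro x
    by_cases hx : x ∈ core
    · have h1 : slope f x ≤ 1 := by
        have := slope_le_of_eventually (f := f) (x := x) (K := 1) (by
          filter_upwards [isOpen_core.mem_nhds hx] with y hy
          rw [one_mul]
          exact hcore x hx y hy)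
        simpa using this
      rw [indicator_of_mem hx]
      calc slope f x ^ 2 ≤ 1 ^ 2 := by gcongr
        _ ≤ _ := by rw [one_pow]; exact le_self_add
    by_cases hb : x ∈ box
    · have h1 : slope f x ≤ 2 := by
        have := slope_le_of_eventually (f := f) (x := x) (K := 2)
          (Eventually.of_forall fun y => hf.dist_le_mul y x)
        simpa using this
      rw [indicator_of_notMem hx, indicator_of_mem (show x ∈ box \ core from ⟨hb, hx⟩), zero_add]
      calc slope f x ^ 2 ≤ 2 ^ 2 := by gcongr
        _ = 4 := by norm_num
    · have hz : ∀ y, y ∉ box → f y = 0 := fun y hy => by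
        by_contra hne
        exact hy (hsupp hne)
      have h1 : slope f x ≤ 0 := by
        have := slope_le_of_eventually (f := f) (x := x) (K := 0) (by
          filter_upwards [isClosed_box.isOpen_compl.mem_nhds hb] with y hy
          rw [hz y hy, hz x hb]
          simp)
        simpa using this
      rw [le_antisymm h1 zero_le]
      simp
  calc slopeEnergy lebesgue f ≤ ∫⁻ x, (core.indicator (fun _ => (1 : ℝ≥0∞)) x +
      (box \ core).indicator (fun _ => (4 : ℝ≥0∞)) x) ∂lebesgue := lintegral_mono hpt
    _ = lebesgue core + 4 * lebesgue (box \ core) := by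
        rw [lintegral_add_left (measurable_const.indicator isOpen_core.measurableSet),
          lintegral_indicator_const isOpen_core.measurableSet,
          lintegral_indicator_const (isClosed_box.measurableSet.diff isOpen_core.measurableSet),
          one_mul]
    _ = ENNReal.ofReal 2256 := by
        rw [lebesgue_core, lebesgue_box_diff_core,
          show (4 : ℝ≥0∞) = ENNReal.ofReal 4 by norm_num, ← ENNReal.ofReal_mul (by norm_num),
          ← ENNReal.ofReal_add (by norm_num) (by norm_num)]
        norm_num

/-- On `A` neither `x` nor its translate is affected by the cutoff and no corner is crossed, so the
increment is exactly `1/8`. -/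
theorem le_lintegral_corrugation {e : L1Plane} {A : Set L1Plane} (hAm : MeasurableSet A)
    (hA : lebesgue A = ENNReal.ofReal 1200)
    (hle : ∀ x, l (x + (1 / 8 : ℝ) • e) = l x + 1 / 8)
    (hAe : ∀ x ∈ A, l x ∈ smoothPart ∧ x ∈ core ∧ |(x + (1 / 8 : ℝ) • e).fst| ≤ 20 + 1 / 2 ∧
      |(x + (1 / 8 : ℝ) • e).snd| ≤ 20 + 1 / 2) :
    ENNReal.ofReal (1 / 8) ^ 2 * ENNReal.ofReal 1200 ≤
      ∫⁻ x, ‖corrugation l (x + (1 / 8 : ℝ) • e) - corrugation l x‖ₑ ^ 2 ∂lebesgue := by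
  rw [← hA, ← setLIntegral_const]
  refine (setLIntegral_mono' hAm fun x hx => ?_).trans (setLIntegral_le_lintegral A _)
  obtain ⟨h1, h2, h3, h4⟩ := hAe x hx
  rw [corrugation_eq_sawtooth h3 h4, hle, corrugation_eq_sawtooth
    (abs_le.2 ⟨by linarith [h2.1.1], by linarith [h2.1.2]⟩)
    (abs_le.2 ⟨by linarith [h2.2.1], by linarith [h2.2.2]⟩), ← ofReal_norm, Real.norm_eq_abs,
    abs_sub_of_mem_smoothPart h1]

end Corrugation

/-! ### Parallelogram law for the relaxed energy -/

section Sobolev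

variable {X : Type u} [MetricSpace X] [MeasurableSpace X] {m : Measure X}

theorem isApproxSeq_const {f : Lp ℝ 2 m} {u : X → ℝ} (hfu : f =ᵐ[m] u)
    (hu : IsBddSuppLipschitz u) : IsApproxSeq m f fun _ => u := by
  refine ⟨fun _ => hu, ?_⟩
  have h : eLpNorm (fun x => u x - f x) 2 m = 0 := by
    rw [eLpNorm_congr_ae (g := 0), eLpNorm_zero]
    filter_upwards [hfu] with x hx
    rw [hx]
    simp
  exact (tendsto_congr fun _ => h).2 tendsto_const_nhds

theorem relaxedEnergy_le_slopeEnergy {f : Lp ℝ 2 m} {u : X → ℝ} (hfu : f =ᵐ[m] u)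
    (hu : IsBddSuppLipschitz u) : relaxedEnergy m f ≤ slopeEnergy m u :=
  (iInf₂_le _ (isApproxSeq_const hfu hu)).trans (by simp)

theorem mem_sobolevSpace [BorelSpace X] {f : Lp ℝ 2 m} {u : X → ℝ} (hfu : f =ᵐ[m] u)
    (hu : IsBddSuppLipschitz u) (hfin : slopeEnergy m u < ⊤) : f ∈ sobolevSpace m :=
  ⟨_, isApproxSeq_const hfu hu, by simpa using hfin⟩

theorem innerProductSpaceCore_parallelogram {V : Type*} [AddCommGroup V] [Module ℝ V]
    (c : InnerProductSpace.Core ℝ V) (f g : V) :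
    c.inner (f + g) (f + g) + c.inner (f - g) (f - g) = 2 * c.inner f f + 2 * c.inner g g := by
  have hadd : ∀ x y z, c.inner (x + y) z = c.inner x z + c.inner y z := c.add_left
  have hsymm : ∀ x y, c.inner x y = c.inner y x := fun x y => by
    have := c.conj_inner_symm x y
    simpa using this.symm
  have hadd' : ∀ x y z, c.inner x (y + z) = c.inner x y + c.inner x z := fun x y z => by
    rw [hsymm, hadd, hsymm y, hsymm z]
  have hneg : ∀ x y, c.inner (-x) y = -c.inner x y := fun x y => by
    have := c.smul_left x y (-1)
    simpa using this
  have hneg' : ∀ x y, c.inner x (-y) = -c.inner x y := fun x y => by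
    rw [hsymm, hneg, hsymm]
  simp only [sub_eq_add_neg, hadd, hadd', hneg, hneg']
  rw [hsymm g f]
  ring

/-- The squared Sobolev norm and the squared `L²` norm both satisfy the parallelogram law, hence so
does their difference. -/
theorem IsInfinitesimallyHilbertian.parallelogram [BorelSpace X]
    (h : IsInfinitesimallyHilbertian m)
    (f g : sobolevSpace m) :
    (relaxedEnergy m ((f + g : sobolevSpace m) : Lp ℝ 2 m)).toReal +
        (relaxedEnergy m ((f - g : sobolevSpace m) : Lp ℝ 2 m)).toReal =
      2 * (relaxedEnergy m (f : Lp ℝ 2 m)).toReal + 2 * (relaxedEnergy m (g : Lp ℝ 2 m)).toReal := by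
  obtain ⟨c, hc⟩ := h
  have hsq : ∀ f : sobolevSpace m, c.inner f f =
      ‖(f : Lp ℝ 2 m)‖ ^ 2 + (relaxedEnergy m (f : Lp ℝ 2 m)).toReal := fun f => by
    rw [hc, sobolevNorm, Real.sq_sqrt (by positivity)]
  have h1 := innerProductSpaceCore_parallelogram c f g
  rw [hsq, hsq, hsq, hsq] at h1
  have h2 := parallelogram_law_with_norm ℝ (f : Lp ℝ 2 m) (g : Lp ℝ 2 m)
  simp only [Submodule.coe_add, Submodule.coe_sub] at h1 ⊢
  nlinarith

end Sobolev

/-! ### The `ℓ¹` plane is not infinitesimally Hilbertian -/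

section NonHilbertian

instance : normalisedLebesgue.IsAddHaarMeasure :=
  Measure.IsAddHaarMeasure.smul lebesgue (ENNReal.inv_ne_zero.2 lebesgue_unitBall_ne_top)
    (ENNReal.inv_ne_top.2 lebesgue_unitBall_pos.ne')

theorem slopeEnergy_normalisedLebesgue (f : L1Plane → ℝ) :
    slopeEnergy normalisedLebesgue f =
      (lebesgue (Metric.ball 0 1))⁻¹ * slopeEnergy lebesgue f := by
  rw [slopeEnergy, normalisedLebesgue, lintegral_smul_measure, smul_eq_mul, slopeEnergy]

theorem isBddSuppLipschitz_of_support_subset_box {f : L1Plane → ℝ} {K : ℝ≥0}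
    (hf : LipschitzWith K f) (hsupp : Function.support f ⊆ box) : IsBddSuppLipschitz f :=
  ⟨⟨K, hf⟩, isBounded_box.subset hsupp⟩

theorem memLp_of_support_subset_box {f : L1Plane → ℝ} {K : ℝ≥0} (hf : LipschitzWith K f)
    (hsupp : Function.support f ⊆ box) : MemLp f 2 normalisedLebesgue :=
  hf.continuous.memLp_of_hasCompactSupport (HasCompactSupport.intro
    (Metric.isCompact_of_isClosed_isBounded isClosed_box isBounded_box)
    fun _ hx => by_contra fun hne => hx (hsupp hne))

/-- The difference quotient bound at step `t = 1/8`, with the common factor `(1/8)²` cancelled. The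
area `1200 = 30 · 40` is three quarters of the core. -/
theorem le_relaxedEnergy_of_corrugation {l : L1Plane → ℝ} (hl : ∀ x y, |l x - l y| ≤ dist x y)
    {e : L1Plane} (he : ‖e‖ = 1) {A : Set L1Plane} (hAm : MeasurableSet A)
    (hA : lebesgue A = ENNReal.ofReal 1200)
    (hle : ∀ x, l (x + (1 / 8 : ℝ) • e) = l x + 1 / 8)
    (hAe : ∀ x ∈ A, l x ∈ smoothPart ∧ x ∈ core ∧ |(x + (1 / 8 : ℝ) • e).fst| ≤ 20 + 1 / 2 ∧
      |(x + (1 / 8 : ℝ) • e).snd| ≤ 20 + 1 / 2)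
    {f : Lp ℝ 2 normalisedLebesgue} (hf : f =ᵐ[normalisedLebesgue] corrugation l) :
    (lebesgue (Metric.ball 0 1))⁻¹ * ENNReal.ofReal 1200 ≤ relaxedEnergy normalisedLebesgue f := by
  have h1 := lintegral_enorm_sub_sq_le_relaxedEnergy normalisedLebesgue f hf
    (lipschitzWith_corrugation hl).continuous he (t := 1 / 8) (by norm_num)
  have h2 : ENNReal.ofReal (1 / 8) ^ 2 * ((lebesgue (Metric.ball 0 1))⁻¹ * ENNReal.ofReal 1200) ≤
      ENNReal.ofReal (1 / 8) ^ 2 * relaxedEnergy normalisedLebesgue f := by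
    refine le_trans ?_ h1
    rw [normalisedLebesgue, lintegral_smul_measure, smul_eq_mul, mul_left_comm]
    gcongr
    exact le_lintegral_corrugation hAm hA hle hAe
  exact (ENNReal.mul_le_mul_iff_right (by simp) (by finiteness)).1 h2

theorem le_relaxedEnergy_corrugation_fst {f : Lp ℝ 2 normalisedLebesgue}
    (hf : f =ᵐ[normalisedLebesgue] corrugation fun x => x.fst) :
    (lebesgue (Metric.ball 0 1))⁻¹ * ENNReal.ofReal 1200 ≤ relaxedEnergy normalisedLebesgue f := by
  refine le_relaxedEnergy_of_corrugation (e := WithLp.toLp 1 (1, 0))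
    (A := {p | p.fst ∈ smoothPart ∧ p.snd ∈ Ioo (-20) 20}) abs_fst_sub_le ?_ ?_ ?_ ?_ ?_ hf
  · rw [L1Plane.norm_def]
    simp
  · exact (continuous_fst_l1.measurable measurableSet_smoothPart).inter
      (continuous_snd_l1.measurable measurableSet_Ioo)
  · rw [lebesgue_prod, volume_smoothPart, Real.volume_Ioo, ← ENNReal.ofReal_mul (by norm_num)]
    norm_num
  · intro x
    simp
  · intro x hx
    have h1 := smoothPart_subset hx.1
    have h2 := hx.2
    refine ⟨hx.1, ⟨h1, h2⟩, abs_le.2 ?_, abs_le.2 ?_⟩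
    · change -(20 + 1 / 2) ≤ x.fst + 1 / 8 * (1 : ℝ) ∧ x.fst + 1 / 8 * (1 : ℝ) ≤ 20 + 1 / 2
      constructor <;> linarith [h1.1, h1.2]
    · change -(20 + 1 / 2) ≤ x.snd + 1 / 8 * (0 : ℝ) ∧ x.snd + 1 / 8 * (0 : ℝ) ≤ 20 + 1 / 2
      constructor <;> linarith [h2.1, h2.2]

theorem le_relaxedEnergy_corrugation_snd {f : Lp ℝ 2 normalisedLebesgue}
    (hf : f =ᵐ[normalisedLebesgue] corrugation fun x => x.snd) :
    (lebesgue (Metric.ball 0 1))⁻¹ * ENNReal.ofReal 1200 ≤ relaxedEnergy normalisedLebesgue f := by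
  refine le_relaxedEnergy_of_corrugation (e := WithLp.toLp 1 (0, 1))
    (A := {p | p.fst ∈ Ioo (-20) 20 ∧ p.snd ∈ smoothPart}) abs_snd_sub_le ?_ ?_ ?_ ?_ ?_ hf
  · rw [L1Plane.norm_def]
    simp
  · exact (continuous_fst_l1.measurable measurableSet_Ioo).inter
      (continuous_snd_l1.measurable measurableSet_smoothPart)
  · rw [lebesgue_prod, volume_smoothPart, Real.volume_Ioo, ← ENNReal.ofReal_mul (by norm_num)]
    norm_num
  · intro x
    simp
  · intro x hx
    have h1 := hx.1
    have h2 := smoothPart_subset hx.2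
    refine ⟨hx.2, ⟨h1, h2⟩, abs_le.2 ?_, abs_le.2 ?_⟩
    · change -(20 + 1 / 2) ≤ x.fst + 1 / 8 * (0 : ℝ) ∧ x.fst + 1 / 8 * (0 : ℝ) ≤ 20 + 1 / 2
      constructor <;> linarith [h1.1, h1.2]
    · change -(20 + 1 / 2) ≤ x.snd + 1 / 8 * (1 : ℝ) ∧ x.snd + 1 / 8 * (1 : ℝ) ≤ 20 + 1 / 2
      constructor <;> linarith [h2.1, h2.2]

theorem corrugation_eq_of_mem_core {l : L1Plane → ℝ} {x : L1Plane} (hx : x ∈ core) :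
    corrugation l x = sawtooth (l x) :=
  corrugation_eq_sawtooth (abs_le.2 ⟨by linarith [hx.1.1], by linarith [hx.1.2]⟩)
    (abs_le.2 ⟨by linarith [hx.2.1], by linarith [hx.2.2]⟩)

theorem not_isInfinitesimallyHilbertian_normalisedLebesgue :
    ¬ IsInfinitesimallyHilbertian normalisedLebesgue := by
  intro hH
  set a : ℝ≥0∞ := (lebesgue (Metric.ball 0 1))⁻¹ with ha
  have ha0 : a ≠ 0 := ENNReal.inv_ne_zero.2 lebesgue_unitBall_ne_top
  have hat : a ≠ ⊤ := ENNReal.inv_ne_top.2 lebesgue_unitBall_pos.ne'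
  have hfin : a * ENNReal.ofReal 2256 < ⊤ := ENNReal.mul_lt_top hat.lt_top ENNReal.ofReal_lt_top
  set u : L1Plane → ℝ := corrugation fun x => x.fst
  set v : L1Plane → ℝ := corrugation fun x => x.snd
  have hu : LipschitzWith 1 u := lipschitzWith_corrugation abs_fst_sub_le
  have hv : LipschitzWith 1 v := lipschitzWith_corrugation abs_snd_sub_le
  have hus : Function.support u ⊆ box := support_corrugation_subset
  have hvs : Function.support v ⊆ box := support_corrugation_subset
  have hadd : LipschitzWith 2 (u + v) := by
    have h := hu.add hv
    rw [one_add_one_eq_two] at h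
    exact h
  have hsub : LipschitzWith 2 (u - v) := by
    have h := hu.sub hv
    rw [one_add_one_eq_two] at h
    exact h
  have hadds : Function.support (u + v) ⊆ box :=
    (Function.support_add u v).trans (union_subset hus hvs)
  have hsubs : Function.support (u - v) ⊆ box :=
    (Function.support_sub u v).trans (union_subset hus hvs)
  have henergy : ∀ f : L1Plane → ℝ, slopeEnergy lebesgue f ≤ ENNReal.ofReal 2256 →
      slopeEnergy normalisedLebesgue f ≤ a * ENNReal.ofReal 2256 := fun f hf => by
    rw [slopeEnergy_normalisedLebesgue]
    gcongr
  have hu' := isBddSuppLipschitz_of_support_subset_box hu hus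
  have hv' := isBddSuppLipschitz_of_support_subset_box hv hvs
  have huE := henergy u (slopeEnergy_le_of_core (hu.weaken one_le_two) hus fun x _ y _ => by
    have h := hu.dist_le_mul y x
    rwa [NNReal.coe_one, one_mul, Real.dist_eq] at h)
  have hvE := henergy v (slopeEnergy_le_of_core (hv.weaken one_le_two) hvs fun x _ y _ => by
    have h := hv.dist_le_mul y x
    rwa [NNReal.coe_one, one_mul, Real.dist_eq] at h)
  -- This is where the `ℓ¹` distance matters: each function uses up only its own coordinate's share
  -- of the distance, so `u ± v` remain 1-Lipschitz on the core.
  have hcore : ∀ x ∈ core, ∀ y ∈ core, |u y - u x| + |v y - v x| ≤ dist y x := by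
    intro x hx y hy
    rw [L1Plane.dist_def]
    simp only [u, v, corrugation_eq_of_mem_core hx, corrugation_eq_of_mem_core hy]
    exact add_le_add (abs_sawtooth_sub_le _ _) (abs_sawtooth_sub_le _ _)
  have haddE := henergy (u + v) (slopeEnergy_le_of_core hadd hadds fun x hx y hy => by
    refine le_trans ?_ (hcore x hx y hy)
    simp only [Pi.add_apply]
    rw [add_sub_add_comm]
    exact abs_add_le _ _)
  have hsubE := henergy (u - v) (slopeEnergy_le_of_core hsub hsubs fun x hx y hy => by
    refine le_trans ?_ (hcore x hx y hy)
    simp only [Pi.sub_apply]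
    rw [sub_sub_sub_comm]
    exact abs_sub _ _)
  have huL := memLp_of_support_subset_box hu hus
  have hvL := memLp_of_support_subset_box hv hvs
  let f : sobolevSpace normalisedLebesgue :=
    ⟨huL.toLp u, mem_sobolevSpace huL.coeFn_toLp hu' (huE.trans_lt hfin)⟩
  let g : sobolevSpace normalisedLebesgue :=
    ⟨hvL.toLp v, mem_sobolevSpace hvL.coeFn_toLp hv' (hvE.trans_lt hfin)⟩
  have hpar := hH.parallelogram f g
  have h1 : relaxedEnergy normalisedLebesgue ((f + g : sobolevSpace normalisedLebesgue) :
      Lp ℝ 2 normalisedLebesgue) ≤ a * ENNReal.ofReal 2256 :=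
    (relaxedEnergy_le_slopeEnergy (huL.add hvL).coeFn_toLp
      (isBddSuppLipschitz_of_support_subset_box hadd hadds)).trans haddE
  have h2 : relaxedEnergy normalisedLebesgue ((f - g : sobolevSpace normalisedLebesgue) :
      Lp ℝ 2 normalisedLebesgue) ≤ a * ENNReal.ofReal 2256 :=
    (relaxedEnergy_le_slopeEnergy (huL.sub hvL).coeFn_toLp
      (isBddSuppLipschitz_of_support_subset_box hsub hsubs)).trans hsubE
  have h3 : a * ENNReal.ofReal 1200 ≤ relaxedEnergy normalisedLebesgue (f : Lp ℝ 2 _) :=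
    le_relaxedEnergy_corrugation_fst huL.coeFn_toLp
  have h4 : a * ENNReal.ofReal 1200 ≤ relaxedEnergy normalisedLebesgue (g : Lp ℝ 2 _) :=
    le_relaxedEnergy_corrugation_snd hvL.coeFn_toLp
  have h5 : relaxedEnergy normalisedLebesgue (f : Lp ℝ 2 _) < ⊤ :=
    ((relaxedEnergy_le_slopeEnergy huL.coeFn_toLp hu').trans huE).trans_lt hfin
  have h6 : relaxedEnergy normalisedLebesgue (g : Lp ℝ 2 _) < ⊤ :=
    ((relaxedEnergy_le_slopeEnergy hvL.coeFn_toLp hv').trans hvE).trans_lt hfin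
  have e1 := ENNReal.toReal_mono hfin.ne h1
  have e2 := ENNReal.toReal_mono hfin.ne h2
  have e3 := ENNReal.toReal_mono h5.ne h3
  have e4 := ENNReal.toReal_mono h6.ne h4
  rw [ENNReal.toReal_mul, ENNReal.toReal_ofReal (by norm_num)] at e1 e2 e3 e4
  have hpos := ENNReal.toReal_pos ha0 hat
  -- The parallelogram law would give `4 · 1200 ≤ 2 · 2256`, that is `4800 ≤ 4512`, up to the
  -- positive factor `a`.
  linarith

end NonHilbertian

end MMS

theorem theorem1p1 :
    ∃ C : Set ℝ, MMS.IsCantorSet C ∧ 0 < volume C ∧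
      MMS.IsMetricMeasureSpace (MMS.squareMeasure C) ∧
      MMS.IsInfinitesimallyHilbertian (MMS.squareMeasure C) ∧
      MMS.IsRectifiable (MMS.squareMeasure C) ∧
      MMS.IsAhlforsRegular (MMS.squareMeasure C) 2 ∧
      (MMS.sobolevSpace (MMS.squareMeasure C) = ⊤ ∧
        ∀ f : MMS.sobolevSpace (MMS.squareMeasure C),
          MMS.sobolevNorm (MMS.squareMeasure C) f =
            ‖(f : Lp ℝ 2 (MMS.squareMeasure C))‖) ∧
      ∀ᵐ x ∂(MMS.squareMeasure C),
        x ∈ (MMS.squareMeasure C).support ∧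
        MMS.pointedL1Plane ∈ MMS.tangentCone (MMS.squareMeasure C) x ∧
        (∀ Y : MMS.PointedMMSpace.{u}, Y ∈ MMS.tangentCone (MMS.squareMeasure C) x →
          Y.IsIsomorphic MMS.pointedL1Plane) ∧
        ¬ MMS.IsInfinitesimallyHilbertian MMS.pointedL1Plane.measure := by
  have hC := MMS.isCompact_fatCantor
  have := MMS.compactSpace_square hC
  have := MMS.isFiniteMeasure_squareMeasure hC
  have := MMS.totallyDisconnectedSpace_square MMS.isCantorSet_fatCantor.totallyDisconnected
  refine ⟨MMS.fatCantor, MMS.isCantorSet_fatCantor, MMS.volume_fatCantor_pos,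
    MMS.isMetricMeasureSpace_square hC, MMS.isInfinitesimallyHilbertian_of_totallyDisconnected _,
    MMS.isRectifiable_square hC, MMS.isAhlforsRegular_square,
    ⟨MMS.sobolevSpace_eq_top _, MMS.sobolevNorm_eq_norm _⟩, ?_⟩
  filter_upwards [MMS.ae_isDensityPoint_square hC] with x hx
  exact ⟨MMS.mem_support_squareMeasure x,
    MMS.pointedL1Plane_mem_tangentCone hC hx (MMS.mem_support_squareMeasure x),
    fun Y hY => MMS.isIsomorphic_of_mem_tangentCone hC hx hY,
    MMS.not_isInfinitesimallyHilbertian_normalisedLebesgue⟩
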